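/- Let $\mathfrak A$ be a unital C*-algebra, $\varphi$ a state on $\mathfrak A$ and $\Phi:\mathfrak A\to\mathfrak A$ a unital $*$-homomorphism with $\varphi\circ\Phi=\varphi$. Let $(\mathcal H_\varphi,\pi_\varphi,\Omega_\varphi)$ be the GNS representation of $\varphi$ and $U$ the isometry of $\mathcal H_\varphi$ with $U\pi_\varphi(a)\Omega_\varphi=\pi_\varphi(\Phi(a))\Omega_\varphi$. Assume that $\Omega_\varphi$ is cyclic for $\pi_\varphi(\mathfrak A)'$ and that $\Phi$ has a $\varphi$-adjoint, that is, a unital completely positive (ucp) map $\Phi^\sharp:\mathfrak A\to\mathfrak A$ with $\varphi(a\Phi^\sharp(b))=\varphi(\Phi(a)b)$ for all $a,b\in\mathfrak A$. A W*-dynamical system is a triple of a von Neumann algebra, a normal (ultraweakly continuous) ucp map of it, and a faithful normal state invariant under this map. A reversible dilation of a W*-dynamical system $(\mathfrak M,\Theta,\omega)$ consists of a W*-dynamical system $(\widehat{\mathfrak M},\widehat\Theta,\widehat\omega)$ with $\widehat\Theta$ an automorphism, a normal injective unital $*$-homomorphism $i:\mathfrak M\to\widehat{\mathfrak M}$ and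 a normal ucp map $\mathcal E:\widehat{\mathfrak M}\to\mathfrak M$ such that $\mathcal E(i(A)X)=A\,\mathcal E(X)$, $\mathcal E(\widehat\Theta^n(i(A)))=\Theta^n(A)$ and $\widehat\omega(X)=\omega(\mathcal E(X))$ for all $A\in\mathfrak M$, $X\in\widehat{\mathfrak M}$, $n\in\mathbb N$. It is minimal if $\widehat{\mathfrak M}$ is the von Neumann algebra generated by $\bigcup_{k\in\mathbb Z}\widehat\Theta^k(i(\mathfrak M))$. A covariant GNS representation of $(\mathfrak A,\Phi,\varphi)$ consists of a Hilbert space $\mathcal H_\infty$, a linear isometry $Z_0:\mathcal H_\varphi\to\mathcal H_\infty$, a unital $*$-representation $\pi_\infty$ of $\mathfrak A$ on $\mathcal H_\infty$ with $\pi_\infty(a)Z_0=Z_0\pi_\varphi(a)$, the vector $\Omega_\infty=Z_0\Omega_\varphi$, and an isometry $V_\infty$ of $\mathcal H_\infty$ with $Z_0^*V_\infty^nZ_0=(U^*)^n$ for all $n\in\mathbb N$, $V_\infty\Omega_\infty=\Omega_\infty$, $\pi_\infty(\Phi(a))=V_\infty^*\pi_\infty(a)V_\infty$ and $\varphi(a)=\langle\Omega_\infty,\pi_\infty(a)\Omega_\infty\rangle$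 for all $a\in\mathfrak A$, such that $\Omega_\infty$ is cyclic for the $*$-algebra $\mathfrak B$ generated by all $V_\infty^n\pi_\infty(a)V_\infty^{*n}$, $n\in\mathbb N$, $a\in\mathfrak A$. Then a covariant GNS representation exists; there is a W*-dynamical system $(\pi_\varphi(\mathfrak A)'',\Phi_\bullet,\varphi_\bullet)$ with $\Phi_\bullet(X)\Omega_\varphi=UX\Omega_\varphi$ and $\varphi_\bullet(X)=\langle\Omega_\varphi,X\Omega_\varphi\rangle$ for all $X\in\pi_\varphi(\mathfrak A)''$; and for every covariant GNS representation this system has a minimal reversible dilation $(\widehat{\mathfrak M},\widehat\Phi,\widehat\varphi,i,\mathcal E)$ with 1. $\widehat{\mathfrak M}=\mathfrak B''$; 2. $i(A)\Omega_\infty=Z_0A\Omega_\varphi$ for all $A\in\pi_\varphi(\mathfrak A)''$, and $\widehat\Phi(X)=V_\infty^*XV_\infty$ for all $X\in\mathfrak B''$; 3. $\mathcal E(X)=Z_0^*XZ_0$ for all $X\in\mathfrak B''$, so that $\mathcal E(V_\infty^k\pi_\infty(a)V_\infty^{*k})=\pi_\varphi((\Phi^{\sharp})^k(a))$ for all $a\in\mathfrak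 A$, $k\in\mathbb N$, and $\widehat\varphi(X)=\langle\Omega_\infty,X\Omega_\infty\rangle$ for all $X\in\mathfrak B''$. -/

import Mathlib

open scoped ComplexOrder InnerProductSpace CStarAlgebra

universe u v

noncomputable section

/-! ### Von Neumann algebras, normal maps, unital completely positive maps -/

section VonNeumann

variable {H : Type*} [NormedAddCommGroup H] [InnerProductSpace ℂ H] [CompleteSpace H]
variable {K : Type*} [NormedAddCommGroup K] [InnerProductSpace ℂ K] [CompleteSpace K]

/-- The double commutant `𝔅″` of a *-subalgebra `𝔅` of `B(H)`, as a von Neumann algebra. -/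
def doubleCommutant (B : StarSubalgebra ℂ (H →L[ℂ] H)) : VonNeumannAlgebra H where
  toStarSubalgebra :=
    StarSubalgebra.centralizer ℂ (StarSubalgebra.centralizer ℂ (B : Set (H →L[ℂ] H)))
  centralizer_centralizer' := by
    change Set.centralizer (Set.centralizer (StarSubalgebra.centralizer ℂ
      (StarSubalgebra.centralizer ℂ (B : Set (H →L[ℂ] H)) : Set (H →L[ℂ] H)) : Set (H →L[ℂ] H)))
        = (StarSubalgebra.centralizer ℂ
      (StarSubalgebra.centralizer ℂ (B : Set (H →L[ℂ] H)) : Set (H →L[ℂ] H)) : Set (H →L[ℂ] H))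
    rw [StarSubalgebra.coe_centralizer_centralizer, Set.centralizer_centralizer_centralizer]

/-- A vector `Ω` is cyclic for a set `B` of operators if `{X Ω : X ∈ B}` is total. -/
def IsCyclicVector (B : Set (H →L[ℂ] H)) (Ω : H) : Prop :=
  Dense (Submodule.span ℂ {x : H | ∃ X ∈ B, x = X Ω} : Set H)

/-- The ultraweak (σ-weak) topology on `B(H)`: the coarsest topology for which all functionals
`X ↦ ∑ ⟨ξₙ, X ηₙ⟩` with `∑ ‖ξₙ‖² < ∞` and `∑ ‖ηₙ‖² < ∞` are continuous. -/
@[reducible]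
def ultraweakTopology (H : Type*) [NormedAddCommGroup H] [InnerProductSpace ℂ H] :
    TopologicalSpace (H →L[ℂ] H) :=
  ⨅ (ξ : ℕ → H) (η : ℕ → H) (_ : Summable fun n => ‖ξ n‖ ^ 2) (_ : Summable fun n => ‖η n‖ ^ 2),
    TopologicalSpace.induced (fun X : H →L[ℂ] H => ∑' n, ⟪ξ n, X (η n)⟫_ℂ) inferInstance

/-- The relative ultraweak topology on a von Neumann algebra. -/
@[reducible]
def relUltraweak (M : VonNeumannAlgebra H) : TopologicalSpace M.toStarSubalgebra :=
  TopologicalSpace.induced (fun X => (X : H →L[ℂ] H)) (ultraweakTopology H)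

/-- A map between von Neumann algebras is normal if it is ultraweakly continuous. -/
def IsNormalMap (M : VonNeumannAlgebra H) (N : VonNeumannAlgebra K)
    (f : M.toStarSubalgebra → N.toStarSubalgebra) : Prop :=
  @Continuous _ _ (relUltraweak M) (relUltraweak N) f

/-- A functional on a von Neumann algebra is normal if it is ultraweakly continuous. -/
def IsNormalFunctional (M : VonNeumannAlgebra H) (f : M.toStarSubalgebra → ℂ) : Prop :=
  @Continuous _ _ (relUltraweak M) inferInstance f

/-- A linear map `f : M → N ⊆ B(K)` is completely positive if
`∑ᵢⱼ ⟨ξᵢ, f(Xᵢ* Xⱼ) ξⱼ⟩ ≥ 0` for all finite families `Xᵢ ∈ M`, `ξᵢ ∈ K`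
(positive matrices over `M` are the finite sums of matrices `(Xᵢ* Xⱼ)ᵢⱼ`);
it is a ucp-map if moreover `f(1) = 1`. -/
structure IsUCPMap (M : VonNeumannAlgebra H) (N : VonNeumannAlgebra K)
    (f : M.toStarSubalgebra →ₗ[ℂ] N.toStarSubalgebra) : Prop where
  map_one : f 1 = 1
  completely_positive : ∀ (n : ℕ) (X : Fin n → M.toStarSubalgebra) (ξ : Fin n → K),
    0 ≤ ∑ i, ∑ j, ⟪ξ i, (f (star (X i) * X j) : K →L[ℂ] K) (ξ j)⟫_ℂ

/-- A W*-dynamical system `(M, Φ, φ)` on a von Neumann algebra `M`: a normal ucp-map `Φ` of `M`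
and a faithful normal state `φ` of `M` with `φ ∘ Φ = φ`. -/
structure WStarDynamicalSystem (M : VonNeumannAlgebra H) where
  dynamics : M.toStarSubalgebra →ₗ[ℂ] M.toStarSubalgebra
  state : M.toStarSubalgebra →ₗ[ℂ] ℂ
  dynamics_ucp : IsUCPMap M M dynamics
  dynamics_normal : IsNormalMap M M dynamics
  state_nonneg : ∀ X, 0 ≤ state (star X * X)
  state_one : state 1 = 1
  state_normal : IsNormalFunctional M state
  state_faithful : ∀ X, state (star X * X) = 0 → X = 0
  invariant : ∀ X, state (dynamics X) = state X

/-- A reversible dilation `(N, Φ̂, φ̂, i, ℰ)`, with underlying von Neumann algebra `N`, of the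
W*-dynamical system `W = (M, Φ, φ)`. -/
structure ReversibleDilation {M : VonNeumannAlgebra H} (W : WStarDynamicalSystem M)
    (N : VonNeumannAlgebra K) where
  /-- the W*-dynamical system `(N, Φ̂, φ̂)` -/
  system : WStarDynamicalSystem N
  /-- the dynamics `Φ̂`, as a *-automorphism -/
  automorphism : N.toStarSubalgebra ≃⋆ₐ[ℂ] N.toStarSubalgebra
  dynamics_eq : ∀ X, system.dynamics X = automorphism X
  /-- the injective normal homomorphism `i` -/
  embedding : M.toStarSubalgebra →⋆ₐ[ℂ] N.toStarSubalgebra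
  embedding_injective : Function.Injective embedding
  embedding_normal : IsNormalMap M N embedding
  /-- the normal ucp-map `ℰ` -/
  expectation : N.toStarSubalgebra →ₗ[ℂ] M.toStarSubalgebra
  expectation_ucp : IsUCPMap N M expectation
  expectation_normal : IsNormalMap N M expectation
  expectation_embedding_mul : ∀ A X, expectation (embedding A * X) = A * expectation X
  expectation_dynamics : ∀ (n : ℕ) (A : M.toStarSubalgebra),
    expectation ((system.dynamics)^[n] (embedding A)) = (W.dynamics)^[n] A
  state_eq : ∀ X, system.state X = W.state (expectation X)

/-- The dilation is minimal if `N` is the von Neumann algebra generated by all `Φ̂ᵏ(i(A))`,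
`k ∈ ℤ`, `A ∈ M`. -/
def ReversibleDilation.IsMinimal {M : VonNeumannAlgebra H} {W : WStarDynamicalSystem M}
    {N : VonNeumannAlgebra K} (D : ReversibleDilation W N) : Prop :=
  ∀ R : VonNeumannAlgebra K,
    (∀ (k : ℤ) (A : M.toStarSubalgebra),
      (((D.automorphism ^ k) (D.embedding A) : N.toStarSubalgebra) : K →L[ℂ] K) ∈ R) → N ≤ R

end VonNeumann

/-! ### C*-dynamical systems with multiplicative dynamics -/

/-- A C*-dynamical system `(𝔄, Φ, φ)` whose dynamics `Φ` is a (unital *-)homomorphism: `φ` is a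
state on the unital C*-algebra `𝔄` with `φ ∘ Φ = φ`. -/
structure MultiplicativeSystem (A : Type*) [CStarAlgebra A] [PartialOrder A]
    [StarOrderedRing A] where
  dynamics : A →⋆ₐ[ℂ] A
  state : A →ₚ[ℂ] ℂ
  state_one : state 1 = 1
  invariant : ∀ a, state (dynamics a) = state a

namespace MultiplicativeSystem

variable {A : Type*} [CStarAlgebra A] [PartialOrder A] [StarOrderedRing A]
variable (S : MultiplicativeSystem A)

/-- The GNS Hilbert space `H_φ`. -/
abbrev GNSSpace : Type _ := S.state.GNS

/-- The GNS representation `π_φ`. -/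
abbrev gnsRep : A →⋆ₐ[ℂ] (S.GNSSpace →L[ℂ] S.GNSSpace) := S.state.gnsStarAlgHom

/-- The GNS vector `Ω_φ`, the class of `1`. -/
def gnsVector : S.GNSSpace := ((S.state.toPreGNS 1 : S.state.PreGNS) : S.state.GNS)

/-- The von Neumann algebra `π_φ(𝔄)″`. -/
def gnsAlgebra : VonNeumannAlgebra S.GNSSpace := doubleCommutant S.gnsRep.range

/-- The map `a ↦ Φ(a)` on `𝔄` with the seminorm `φ(a*a)^{1/2}`. -/
def preU : S.state.PreGNS →ₗᵢ[ℂ] S.state.PreGNS where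
  toLinearMap := S.state.toPreGNS.toLinearMap ∘ₗ S.dynamics.toAlgHom.toLinearMap ∘ₗ
    S.state.ofPreGNS.toLinearMap
  norm_map' a := by
    rw [PositiveLinearMap.preGNS_norm_def, PositiveLinearMap.preGNS_norm_def]
    have h : star (S.dynamics (S.state.ofPreGNS a)) * S.dynamics (S.state.ofPreGNS a)
        = S.dynamics (star (S.state.ofPreGNS a) * S.state.ofPreGNS a) := by
      rw [map_mul, map_star]
    have h2 := S.invariant (star (S.state.ofPreGNS a) * S.state.ofPreGNS a)
    rw [← h] at h2
    exact congrArg (fun z : ℂ => Real.sqrt z.re) h2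

/-- The operator `U_{Φ,φ}` on `H_φ`, the continuous extension of
`π_φ(a) Ω_φ ↦ π_φ(Φ(a)) Ω_φ`. -/
def U : S.GNSSpace →L[ℂ] S.GNSSpace := S.preU.toContinuousLinearMap.completion

theorem gnsRep_gnsVector (a : A) :
    S.gnsRep a S.gnsVector = ((S.state.toPreGNS a : S.state.PreGNS) : S.state.GNS) := by
  simp [gnsVector, PositiveLinearMap.gnsStarAlgHom_apply]

theorem U_apply (a : A) :
    S.U (S.gnsRep a S.gnsVector) = S.gnsRep (S.dynamics a) S.gnsVector := by
  rw [gnsRep_gnsVector, gnsRep_gnsVector]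
  simp [U, preU]

/-- `W` is the W*-dynamical system `(π_φ(𝔄)″, Φ_•, φ_•)` associated to `(𝔄, Φ, φ)`:
`Φ_•(X) Ω_φ = U_{Φ,φ} X Ω_φ` and `φ_•(X) = ⟨Ω_φ, X Ω_φ⟩`. -/
structure IsAssociated (W : WStarDynamicalSystem S.gnsAlgebra) : Prop where
  dynamics_eq : ∀ X : S.gnsAlgebra.toStarSubalgebra,
    (W.dynamics X : S.GNSSpace →L[ℂ] S.GNSSpace) S.gnsVector
      = S.U ((X : S.GNSSpace →L[ℂ] S.GNSSpace) S.gnsVector)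
  state_eq : ∀ X : S.gnsAlgebra.toStarSubalgebra,
    W.state X = ⟪S.gnsVector, (X : S.GNSSpace →L[ℂ] S.GNSSpace) S.gnsVector⟫_ℂ

/-- `Φ♯` is a `φ`-adjoint of `Φ`: a ucp-map of `𝔄` with `φ(a Φ♯(b)) = φ(Φ(a) b)`. -/
structure IsStateAdjoint (Ψ : A →CP A) : Prop where
  map_one : Ψ 1 = 1
  adjoint_eq : ∀ a b, S.state (a * Ψ b) = S.state (S.dynamics a * b)

/-- The *-subalgebra `𝔅` of `B(K)` generated by all `Vⁿ π(a) V*ⁿ`, `n ∈ ℕ`, `a ∈ 𝔄`. -/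
def translatesAlgebra {K : Type*} [NormedAddCommGroup K] [InnerProductSpace ℂ K]
    [CompleteSpace K] (π : A →⋆ₐ[ℂ] (K →L[ℂ] K)) (V : K →L[ℂ] K) :
    StarSubalgebra ℂ (K →L[ℂ] K) :=
  StarAlgebra.adjoin ℂ {X | ∃ (n : ℕ) (a : A), X = V ^ n * π a * star V ^ n}

/-- A covariant GNS representation `(π_∞, H_∞, Ω_∞, V_∞)` of `(𝔄, Φ, φ)` on the Hilbert space
`K = H_∞`, with embedding `Z₀ : H_φ → H_∞`. -/
structure CovariantGNS (K : Type*) [NormedAddCommGroup K] [InnerProductSpace ℂ K]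
    [CompleteSpace K] where
  /-- the isometric embedding `Z₀` -/
  Z : S.GNSSpace →L[ℂ] K
  Z_isometry : ∀ h, ‖Z h‖ = ‖h‖
  /-- the representation `π_∞` -/
  π : A →⋆ₐ[ℂ] (K →L[ℂ] K)
  π_Z : ∀ a h, π a (Z h) = Z (S.gnsRep a h)
  /-- the vector `Ω_∞` -/
  Ω : K
  Ω_eq : Ω = Z S.gnsVector
  /-- the isometry `V_∞` -/
  V : K →L[ℂ] K
  V_isometry : ∀ x, ‖V x‖ = ‖x‖
  dilation : ∀ n : ℕ, (ContinuousLinearMap.adjoint Z) ∘L (V ^ n) ∘L Z = star S.U ^ n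
  V_Ω : V Ω = Ω
  cyclic : IsCyclicVector (translatesAlgebra π V : Set (K →L[ℂ] K)) Ω
  covariant : ∀ a, π (S.dynamics a) = star V * π a * V
  state_eq : ∀ a, S.state a = ⟪Ω, π a Ω⟫_ℂ

/-- The von Neumann algebra `𝔅″` of a covariant GNS representation. -/
def CovariantGNS.algebra {S : MultiplicativeSystem A} {K : Type*} [NormedAddCommGroup K]
    [InnerProductSpace ℂ K] [CompleteSpace K] (C : S.CovariantGNS K) : VonNeumannAlgebra K :=
  doubleCommutant (translatesAlgebra C.π C.V)

/-- The element `V_∞ᵏ π_∞(a) V_∞*ᵏ` of `𝔅″`. -/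
def CovariantGNS.translate {S : MultiplicativeSystem A} {K : Type*} [NormedAddCommGroup K]
    [InnerProductSpace ℂ K] [CompleteSpace K] (C : S.CovariantGNS K) (k : ℕ) (a : A) :
    C.algebra.toStarSubalgebra :=
  ⟨C.V ^ k * C.π a * star C.V ^ k,
    StarAlgebra.adjoin_le_centralizer_centralizer ℂ
      (translatesAlgebra C.π C.V : Set (K →L[ℂ] K))
      (StarAlgebra.subset_adjoin ℂ _ (StarAlgebra.subset_adjoin ℂ _ ⟨k, a, rfl⟩))⟩

end MultiplicativeSystem

end

/-! Write `M` for `π_φ(𝔄)″`. The vector `Ω_φ` is cyclic for `π_φ(𝔄)` and for its commutant, so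
elements of `M` are determined by their values at `Ω_φ`.

The `φ`-adjoint enters through one identity, `U* π_φ(a) U = π_φ(Φ♯(a))`. Indeed `U*` sends
`π_φ(b)Ω_φ` to `π_φ(Φ♯(b))Ω_φ`; hence `π_φ(Φ♯(Φ(b))) = π_φ(b)`, so that `Φ(b)` lies in the
multiplicative domain of `π_φ ∘ Φ♯`, and `π_φ(Φ♯(aΦ(b))) = π_φ(Φ♯(a)) π_φ(b)`.

Existence of a covariant GNS representation: on `H_φ ⊕ ker U* ⊕ ker U* ⊕ …`, the space of the
minimal unitary extension of `U`, take for `V` the inverse of that extension and for `π` the sum of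
the `π_φ ∘ Φⁿ`.

In any covariant GNS representation, multiplicativity of `Φ` forces `π_∞(a) V = V π_∞(Φ(a))`,
cyclicity then forces `V` to be unitary, and `V* Z₀ = Z₀ U` follows. Hence `𝔅` is the increasing
union of the `Vᵏ π_∞(𝔄) V*ᵏ`, and its compression satisfies `Z₀* Vᵏ π_∞(a) V*ᵏ Z₀ = π_φ((Φ♯)ᵏ(a))`,
which lies in `π_φ(𝔄)`.

Both normal homomorphisms, `Φ_•` (with `Z = U`) and `i` (with `Z = Z₀`), come from
`exists_normal_starAlgHom`. It defines `i(X)` by `y Z Ω ↦ y Z X Ω` for `y` in the commutant of the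
target; this is bounded because `X` commutes with `Z* y* y Z`. Its second hypothesis, that elements
of `M′` lift along `Z` to the target's commutant, is `exists_intertwining_commutant`; there the
compression into `π_φ(𝔄)` is needed. The lifts also show that `Ω_∞` is cyclic for `𝔅′` and that `Z₀*
𝔅″ Z₀ ⊆ M`. The remaining dilation identities are checked on vectors, often at `Ω_∞` alone. -/

noncomputable section

set_option linter.unusedSectionVars false

open ContinuousLinearMap

/-! ### Operators determined by cyclic vectors, and lifts to the commutant -/

section Operators

variable {H : Type*} [NormedAddCommGroup H] [InnerProductSpace ℂ H] [CompleteSpace H]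
variable {K : Type*} [NormedAddCommGroup K] [InnerProductSpace ℂ K] [CompleteSpace K]

/-- Two operators which agree on `B Ω` coincide if `Ω` is cyclic for `B`. -/
theorem IsCyclicVector.ext {B : Set (H →L[ℂ] H)} {Ω : H} (h : IsCyclicVector B Ω)
    {X Y : H →L[ℂ] K} (hXY : ∀ y ∈ B, X (y Ω) = Y (y Ω)) : X = Y := by
  refine ContinuousLinearMap.ext_on h ?_
  rintro _ ⟨y, hy, rfl⟩
  exact hXY y hy

/-- Operators in the commutant of `B` are determined by their value at a cyclic vector of `B`. -/
theorem IsCyclicVector.eq_of_apply_eq {B : Set (H →L[ℂ] H)} {Ω : H} (h : IsCyclicVector B Ω)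
    {X Y : H →L[ℂ] H} (hX : ∀ y ∈ B, X * y = y * X) (hY : ∀ y ∈ B, Y * y = y * Y)
    (hXY : X Ω = Y Ω) : X = Y := by
  refine h.ext fun y hy => ?_
  have h1 : X (y Ω) = y (X Ω) := congrArg (fun T : H →L[ℂ] H => T Ω) (hX y hy)
  have h2 : Y (y Ω) = y (Y Ω) := congrArg (fun T : H →L[ℂ] H => T Ω) (hY y hy)
  rw [h1, h2, hXY]

theorem IsCyclicVector.dense_map {B : StarSubalgebra ℂ (H →L[ℂ] H)} {Ω : H}
    (h : IsCyclicVector (B : Set (H →L[ℂ] H)) Ω) :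
    Dense ((Subalgebra.toSubmodule B.toSubalgebra).map
      (ContinuousLinearMap.apply ℂ H Ω).toLinearMap : Set H) := by
  refine h.mono (Submodule.span_le.2 ?_)
  rintro _ ⟨X, hX, rfl⟩
  exact ⟨X, hX, rfl⟩

/-- Bounded operators defined on the dense subspace `B Ω`. -/
theorem IsCyclicVector.exists_extension {B : StarSubalgebra ℂ (H →L[ℂ] H)} {Ω : H}
    (h : IsCyclicVector (B : Set (H →L[ℂ] H)) Ω) (T : (H →L[ℂ] H) →ₗ[ℂ] K) (c : ℝ)
    (hT : ∀ y ∈ B, ‖T y‖ ≤ c * ‖y Ω‖) :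
    ∃ R : H →L[ℂ] K, ∀ y ∈ B, R (y Ω) = T y := by
  let e : B →ₗ[ℂ] H :=
    { toFun := fun y => (y : H →L[ℂ] H) Ω
      map_add' := fun _ _ => rfl
      map_smul' := fun _ _ => rfl }
  let f : B →ₗ[ℂ] K :=
    { toFun := fun y => T (y : H →L[ℂ] H)
      map_add' := fun _ _ => map_add T _ _
      map_smul' := fun _ _ => map_smul T _ _ }
  have he : DenseRange e := h.dense_map.mono <| by
    rintro _ ⟨y, hy, rfl⟩
    exact ⟨⟨y, hy⟩, rfl⟩
  refine ⟨f.extendOfNorm e, fun y hy => ?_⟩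
  exact LinearMap.extendOfNorm_eq he ⟨c, fun x => hT x x.2⟩ ⟨y, hy⟩

/-- The modulus of `T`, which commutes with everything that commutes with `T* T`. -/
theorem exists_modulus (T : H →L[ℂ] K) :
    ∃ R : H →L[ℂ] H, star R = R ∧ adjoint T ∘L T = R * R ∧
      ∀ y : H →L[ℂ] H, Commute y (adjoint T ∘L T) → Commute y R := by
  have hpos : 0 ≤ adjoint T ∘L T := by
    rw [ContinuousLinearMap.nonneg_iff_isPositive]
    exact isPositive_adjoint_comp_self T
  refine ⟨CFC.sqrt (adjoint T ∘L T), ?_, ?_, fun y hy => ?_⟩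
  · exact (IsSelfAdjoint.of_nonneg (CFC.sqrt_nonneg _)).star_eq
  · exact (CFC.sqrt_mul_sqrt_self _ hpos).symm
  · exact (Commute.cfcₙ_nnreal hy.symm _).symm

/-- With `R = |T|` one has `‖T z‖ = ‖R z‖`, and `y` commutes with `R`, so `R y x = y R x`. This is
the source of every boundedness estimate for operators defined on a dense orbit. -/
theorem norm_apply_le_of_commute {T : H →L[ℂ] K} {y : H →L[ℂ] H}
    (h : Commute y (adjoint T ∘L T)) (x : H) : ‖T (y x)‖ ≤ ‖y‖ * ‖T x‖ := by
  obtain ⟨R, hR, hTR, hcomm⟩ := exists_modulus T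
  have hnorm : ∀ z, ‖T z‖ = ‖R z‖ := fun z => by
    have h1 : ⟪T z, T z⟫_ℂ = ⟪R z, R z⟫_ℂ := by
      rw [← adjoint_inner_left, ← adjoint_inner_left, ← star_eq_adjoint R, hR]
      exact congrArg (fun S : H →L[ℂ] H => ⟪S z, z⟫_ℂ) hTR
    rw [inner_self_eq_norm_sq_to_K, inner_self_eq_norm_sq_to_K] at h1
    have h2 : ‖T z‖ ^ 2 = ‖R z‖ ^ 2 := by exact_mod_cast h1
    exact (pow_left_inj₀ (norm_nonneg _) (norm_nonneg _) two_ne_zero).1 h2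
  rw [hnorm, hnorm, show R (y x) = y (R x) from
    (congrArg (fun S : H →L[ℂ] H => S x) (hcomm y h).eq).symm]
  exact y.le_opNorm _

/-- An operator `J` in the commutant of `B` with `J (b Ω') = b Z y Ω`. -/
theorem exists_commutant_lift {B : StarSubalgebra ℂ (K →L[ℂ] K)} {Ω : H} {Z : H →L[ℂ] K}
    (hB : IsCyclicVector (B : Set (K →L[ℂ] K)) (Z Ω)) {y : H →L[ℂ] H}
    (hy : ∀ b ∈ B, Commute y (adjoint Z ∘L b ∘L Z)) :
    ∃ J : K →L[ℂ] K, (∀ b ∈ B, b * J = J * b) ∧ J (Z Ω) = Z (y Ω) ∧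
      adjoint J (Z Ω) = Z (adjoint y Ω) := by
  let T : (K →L[ℂ] K) →ₗ[ℂ] K :=
    { toFun := fun b => b (Z (y Ω))
      map_add' := fun _ _ => rfl
      map_smul' := fun _ _ => rfl }
  obtain ⟨J, hJ⟩ := hB.exists_extension T ‖y‖ fun b hb => by
    refine norm_apply_le_of_commute (T := b ∘L Z) ?_ Ω
    have h1 := hy _ (mul_mem (star_mem hb) hb)
    rwa [adjoint_comp, ContinuousLinearMap.comp_assoc]
  refine ⟨J, fun b hb => hB.ext fun c hc => ?_, ?_, ?_⟩
  · have h1 : J (b (c (Z Ω))) = b (c (Z (y Ω))) := hJ (b * c) (mul_mem hb hc)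
    change b (J (c (Z Ω))) = J (b (c (Z Ω)))
    rw [hJ c hc, h1]
    rfl
  · simpa [T] using hJ 1 (one_mem B)
  · rw [← sub_eq_zero, ← inner_self_eq_zero (𝕜 := ℂ)]
    set w := adjoint J (Z Ω) - Z (adjoint y Ω) with hw
    -- The difference is orthogonal to every `c Z Ω`: both terms pair to `⟨Ω, Z* c Z y Ω⟩`, the
    -- second one because `y` commutes with `Z* c Z`.
    have h1 : innerSL ℂ w = 0 := hB.ext fun c hc => by
      change ⟪w, c (Z Ω)⟫_ℂ = 0
      have h2 : J (c (Z Ω)) = c (Z (y Ω)) := hJ c hc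
      have h3 : y (adjoint Z (c (Z Ω))) = adjoint Z (c (Z (y Ω))) :=
        congrArg (fun S : H →L[ℂ] H => S Ω) (hy c hc).eq
      rw [hw, inner_sub_left, adjoint_inner_left, h2, ← adjoint_inner_right Z (adjoint y Ω),
        adjoint_inner_left, h3, adjoint_inner_right, sub_self]
    exact congrArg (fun S : K →L[ℂ] ℂ => S w) h1

end Operators

/-! ### Normal functionals with norm control, and a criterion for normality -/

section Nuclear

variable {H : Type*} [NormedAddCommGroup H] [InnerProductSpace ℂ H] [CompleteSpace H]
variable {K : Type*} [NormedAddCommGroup K] [InnerProductSpace ℂ K] [CompleteSpace K]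

theorem isNormalMap_of_forall {M : VonNeumannAlgebra H} {N : VonNeumannAlgebra K}
    {f : M.toStarSubalgebra → N.toStarSubalgebra}
    (h : ∀ ξ η : ℕ → K, (Summable fun n => ‖ξ n‖ ^ 2) → (Summable fun n => ‖η n‖ ^ 2) →
      IsNormalFunctional M fun X => ∑' n, ⟪ξ n, (f X : K →L[ℂ] K) (η n)⟫_ℂ) :
    IsNormalMap M N f := by
  unfold IsNormalMap relUltraweak ultraweakTopology
  rw [continuous_induced_rng]
  simp only [continuous_iInf_rng, continuous_induced_rng]
  exact h

theorem isNormalFunctional_tsum (M : VonNeumannAlgebra H) {ξ η : ℕ → H}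
    (hξ : Summable fun n => ‖ξ n‖ ^ 2) (hη : Summable fun n => ‖η n‖ ^ 2) :
    IsNormalFunctional M fun X => ∑' n, ⟪ξ n, (X : H →L[ℂ] H) (η n)⟫_ℂ := by
  have h1 : @Continuous _ _ (ultraweakTopology H) inferInstance
      fun X : H →L[ℂ] H => ∑' n, ⟪ξ n, X (η n)⟫_ℂ := by
    rw [continuous_iff_le_induced]
    exact (iInf_le_of_le ξ (iInf_le_of_le η (iInf_le_of_le hξ (iInf_le _ hη))))
  let _ := ultraweakTopology H
  let _ := relUltraweak M
  exact h1.comp continuous_induced_dom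

/-- A functional of the form `X ↦ ∑ ⟨aᵢ, X bᵢ⟩` with `∑ ‖aᵢ‖ ‖bᵢ‖ ≤ c`. -/
def IsNuclear (M : VonNeumannAlgebra H) (c : ℝ) (f : M.toStarSubalgebra → ℂ) : Prop :=
  ∃ (ι : Type) (_ : Countable ι) (a b : ι → H), (Summable fun i => ‖a i‖ * ‖b i‖) ∧
    ∑' i, ‖a i‖ * ‖b i‖ ≤ c ∧ ∀ X, f X = ∑' i, ⟪a i, (X : H →L[ℂ] H) (b i)⟫_ℂ

theorem norm_inner_apply_le (X : H →L[ℂ] H) (a b : H) : ‖⟪a, X b⟫_ℂ‖ ≤ ‖X‖ * (‖a‖ * ‖b‖) :=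
  calc ‖⟪a, X b⟫_ℂ‖ ≤ ‖a‖ * ‖X b‖ := norm_inner_le_norm _ _
    _ ≤ ‖a‖ * (‖X‖ * ‖b‖) := by gcongr; exact X.le_opNorm b
    _ = _ := by ring

variable {M : VonNeumannAlgebra H}

/-- Balancing `a` and `b` so that both have norm `(‖a‖ ‖b‖)^{1/2}`. -/
theorem exists_balanced (a b : H) : ∃ a' b' : H, ‖a'‖ ^ 2 = ‖a‖ * ‖b‖ ∧ ‖b'‖ ^ 2 = ‖a‖ * ‖b‖ ∧
    ∀ T : H →L[ℂ] H, ⟪a', T b'⟫_ℂ = ⟪a, T b⟫_ℂ := by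
  by_cases ha : ‖a‖ = 0
  · rw [norm_eq_zero] at ha
    exact ⟨0, 0, by simp [ha], by simp [ha], fun T => by simp [ha]⟩
  by_cases hb : ‖b‖ = 0
  · rw [norm_eq_zero] at hb
    exact ⟨0, 0, by simp [hb], by simp [hb], fun T => by simp [hb]⟩
  have hq : 0 < ‖b‖ / ‖a‖ := div_pos ((norm_nonneg b).lt_of_ne' hb) ((norm_nonneg a).lt_of_ne' ha)
  have ht : 0 < √(‖b‖ / ‖a‖) := Real.sqrt_pos.2 hq
  refine ⟨((√(‖b‖ / ‖a‖) : ℝ) : ℂ) • a, (((√(‖b‖ / ‖a‖))⁻¹ : ℝ) : ℂ) • b, ?_, ?_, fun T => ?_⟩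
  · rw [norm_smul, mul_pow, Complex.norm_real, Real.norm_of_nonneg ht.le, Real.sq_sqrt hq.le]
    field_simp
  · rw [norm_smul, mul_pow, Complex.norm_real, Real.norm_of_nonneg (inv_nonneg.2 ht.le), inv_pow,
      Real.sq_sqrt hq.le]
    field_simp
  · rw [map_smul, inner_smul_left, inner_smul_right, Complex.conj_ofReal, ← mul_assoc,
      ← Complex.ofReal_mul, mul_inv_cancel₀ ht.ne', Complex.ofReal_one, one_mul]

/-- Balancing turns summability of `‖aᵢ‖ ‖bᵢ‖` into square summability of both families; the
countable index set is then injected into `ℕ` and the gaps are filled with zeros. -/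
theorem IsNuclear.isNormalFunctional {c : ℝ} {f : M.toStarSubalgebra → ℂ}
    (h : IsNuclear M c f) : IsNormalFunctional M f := by
  obtain ⟨ι, _, a, b, hs, -, hf⟩ := h
  choose a' b' ha' hb' hab using fun i => exists_balanced (a i) (b i)
  obtain ⟨e, he⟩ := exists_injective_nat ι
  have key : ∀ x : ι → H, (∀ i, ‖x i‖ ^ 2 = ‖a i‖ * ‖b i‖) →
      Summable fun n => ‖Function.extend e x 0 n‖ ^ 2 := fun x hx => by
    refine (he.summable_iff fun n hn => ?_).1 ?_
    · rw [Function.extend_apply' _ _ _ (by simpa using hn)]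
      simp
    · refine hs.congr fun i => ?_
      simp [he.extend_apply, hx]
  have h2 := isNormalFunctional_tsum M (key a' ha') (key b' hb')
  convert h2 using 2 with X
  rw [hf X, ← he.tsum_eq]
  · refine tsum_congr fun i => ?_
    rw [he.extend_apply, he.extend_apply, hab]
  · intro n hn
    by_contra hn'
    apply hn
    beta_reduce
    rw [Function.extend_apply' _ _ _ (by simpa using hn')]
    simp

theorem isNuclear_inner (a b : H) :
    IsNuclear M (‖a‖ * ‖b‖) fun X => ⟪a, (X : H →L[ℂ] H) b⟫_ℂ :=
  ⟨Unit, inferInstance, fun _ => a, fun _ => b, Summable.of_finite, by simp, by simp⟩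

theorem IsNuclear.mono {c d : ℝ} {f : M.toStarSubalgebra → ℂ} (h : IsNuclear M c f)
    (hcd : c ≤ d) : IsNuclear M d f := by
  obtain ⟨ι, hι, a, b, hs, hc, hf⟩ := h
  exact ⟨ι, hι, a, b, hs, hc.trans hcd, hf⟩

theorem IsNuclear.const_mul {c : ℝ} {f : M.toStarSubalgebra → ℂ} (h : IsNuclear M c f) (z : ℂ) :
    IsNuclear M (‖z‖ * c) fun X => z * f X := by
  obtain ⟨ι, hι, a, b, hs, hc, hf⟩ := h
  have h1 : (fun i => ‖a i‖ * ‖z • b i‖) = fun i => ‖z‖ * (‖a i‖ * ‖b i‖) := by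
    funext i
    rw [norm_smul]
    ring
  refine ⟨ι, hι, a, fun i => z • b i, ?_, ?_, fun X => ?_⟩
  · rw [h1]
    exact hs.mul_left _
  · rw [h1, tsum_mul_left]
    gcongr
  · simp only [map_smul, inner_smul_right, hf X, tsum_mul_left]

/-- Completeness of the predual in concrete form: absolutely convergent series of nuclear
functionals are nuclear, by concatenating the representing families. The bound `c` is carried along
for this purpose. -/
theorem IsNuclear.hasSum {κ : Type} [Countable κ] {c : κ → ℝ}
    {f : κ → M.toStarSubalgebra → ℂ} {g : M.toStarSubalgebra → ℂ}
    (h : ∀ k, IsNuclear M (c k) (f k)) (hc : Summable c) (hg : ∀ X, HasSum (fun k => f k X) (g X)) :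
    IsNuclear M (∑' k, c k) g := by
  choose ι hι a b hs hle hf using h
  have hsig : Summable fun p : Σ k, ι k => ‖a p.1 p.2‖ * ‖b p.1 p.2‖ := by
    refine (summable_sigma_of_nonneg fun p => by positivity).2 ⟨hs, ?_⟩
    exact Summable.of_nonneg_of_le (fun k => tsum_nonneg fun i => by positivity) hle hc
  refine ⟨Σ k, ι k, inferInstance, fun p => a p.1 p.2, fun p => b p.1 p.2, hsig, ?_, fun X => ?_⟩
  · rw [hsig.tsum_sigma' hs]
    exact Summable.tsum_le_tsum hle hsig.sigma hc
  · have hX : Summable fun p : Σ k, ι k => ⟪a p.1 p.2, (X : H →L[ℂ] H) (b p.1 p.2)⟫_ℂ :=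
      Summable.of_norm_bounded (hsig.mul_left ‖(X : H →L[ℂ] H)‖)
        fun p => norm_inner_apply_le _ _ _
    rw [hX.tsum_sigma, ← (hg X).tsum_eq]
    exact tsum_congr fun k => hf k X

theorem IsNuclear.add {c d : ℝ} {f g : M.toStarSubalgebra → ℂ} (hf : IsNuclear M c f)
    (hg : IsNuclear M d g) : IsNuclear M (c + d) fun X => f X + g X := by
  have h := IsNuclear.hasSum (κ := Bool) (c := fun k => cond k c d) (f := fun k => cond k f g)
    (g := fun X => f X + g X) (fun k => by cases k <;> assumption) Summable.of_finite
    (fun X => by simpa using hasSum_fintype (fun k : Bool => (cond k f g) X))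
  simpa using h

/-- A vector in the closure of a subspace `D` is the sum of a series in `D` whose norms are
controlled. -/
theorem exists_hasSum_of_mem_closure {D : Submodule ℂ K} (hD : Dense (D : Set K)) (x : K) :
    ∃ v : ℕ → K, (∀ n, v n ∈ D) ∧ HasSum v x ∧ (Summable fun n => ‖v n‖) ∧
      ∑' n, ‖v n‖ ≤ 3 * ‖x‖ := by
  by_cases hx : x = 0
  · exact ⟨0, fun n => D.zero_mem, hx ▸ hasSum_zero, by simp [summable_zero], by simp⟩
  have hx' : 0 < ‖x‖ := norm_pos_iff.2 hx
  -- The first term is within `‖x‖` of `x`, hence of norm at most `2‖x‖`; the later ones are bounded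
  -- by `‖x‖ / 2ⁿ` and contribute at most `‖x‖`. Together this gives the constant 3.
  obtain ⟨v, hv, hvD, hv0, hvn⟩ := controlled_sum_of_mem_closure
    (s := D.toAddSubgroup) (a := x) (hD x) (b := fun n => ‖x‖ * (1 / 2) ^ n)
    (fun n => by positivity)
  have hgeom : HasSum (fun n : ℕ => ‖x‖ * (1 / 2 : ℝ) ^ n) (‖x‖ * 2) :=
    hasSum_geometric_two.mul_left _
  have hbound : ∀ n, ‖v (n + 1)‖ ≤ ‖x‖ * (1 / 2) ^ (n + 1) := fun n => (hvn _ n.succ_pos).le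
  have hshift : HasSum (fun n : ℕ => ‖x‖ * (1 / 2 : ℝ) ^ (n + 1)) ‖x‖ := by
    have := (hasSum_nat_add_iff' 1).2 hgeom
    simpa [mul_two] using this
  have hs1 : Summable fun n => ‖v (n + 1)‖ :=
    Summable.of_nonneg_of_le (fun n => norm_nonneg _) hbound hshift.summable
  have hs : Summable fun n => ‖v n‖ := (summable_nat_add_iff 1).1 hs1
  refine ⟨v, hvD, ?_, hs, ?_⟩
  · have h1 := (Summable.of_norm hs).hasSum
    have h2 := (h1.tendsto_sum_nat.comp (Filter.tendsto_add_atTop_nat 1))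
    rwa [tendsto_nhds_unique h2 hv] at h1
  · rw [hs.tsum_eq_zero_add]
    have h0 : ‖v 0‖ ≤ 2 * ‖x‖ := by
      have h3 : ‖v 0‖ ≤ ‖v 0 - x‖ + ‖x‖ := by simpa using norm_add_le (v 0 - x) x
      have h4 : ‖v 0 - x‖ < ‖x‖ := by simpa [← sub_eq_neg_add, norm_sub_rev] using hv0
      linarith
    have h1 : ∑' n, ‖v (n + 1)‖ ≤ ‖x‖ := by
      rw [← hshift.tsum_eq]
      exact hs1.tsum_le_tsum hbound hshift.summable
    linarith

/-- Polarization after rescaling `x` and `y` to equal norm, which leaves `⟨x, ρ(X) y⟩` unchanged and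
makes the bound a multiple of the product `‖x‖ ‖y‖`. -/
theorem IsNuclear.polarize {D : Submodule ℂ K} {ρ : M.toStarSubalgebra → K →L[ℂ] K}
    (h : ∀ x ∈ D, IsNuclear M (‖x‖ ^ 2) fun X => ⟪x, ρ X x⟫_ℂ) {x y : K} (hx : x ∈ D)
    (hy : y ∈ D) : IsNuclear M (4 * (‖x‖ * ‖y‖)) fun X => ⟪x, ρ X y⟫_ℂ := by
  by_cases hx0 : ‖x‖ = 0
  · rw [norm_eq_zero] at hx0
    simpa [hx0] using isNuclear_inner (M := M) 0 0
  by_cases hy0 : ‖y‖ = 0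
  · rw [norm_eq_zero] at hy0
    simpa [hy0] using isNuclear_inner (M := M) 0 0
  have hq : 0 < ‖y‖ / ‖x‖ := div_pos ((norm_nonneg y).lt_of_ne' hy0) ((norm_nonneg x).lt_of_ne' hx0)
  have ht : 0 < √(‖y‖ / ‖x‖) := Real.sqrt_pos.2 hq
  set t : ℝ := √(‖y‖ / ‖x‖) with ht_def
  have htsq : t ^ 2 = ‖y‖ / ‖x‖ := Real.sq_sqrt hq.le
  set x' : K := (t : ℂ) • x
  set y' : K := ((t⁻¹ : ℝ) : ℂ) • y
  have hx' : x' ∈ D := D.smul_mem _ hx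
  have hy' : y' ∈ D := D.smul_mem _ hy
  have hnx : ‖x'‖ ^ 2 = ‖x‖ * ‖y‖ := by
    rw [norm_smul, mul_pow, Complex.norm_real, Real.norm_of_nonneg ht.le, htsq]
    field_simp
  have hny : ‖y'‖ ^ 2 = ‖x‖ * ‖y‖ := by
    rw [norm_smul, mul_pow, Complex.norm_real, Real.norm_of_nonneg (inv_nonneg.2 ht.le), inv_pow,
      htsq]
    field_simp
  -- Since `‖x'‖² = ‖y'‖² = ‖x‖ ‖y‖`, one has `‖x' + z y'‖² ≤ 4 ‖x‖ ‖y‖`, and the weight 1/4 cancels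
  -- the 4. The four terms `z = ±1, ±i` give the constant 4.
  have hterm : ∀ z : ℂ, ‖z‖ = 1 → IsNuclear M (‖x‖ * ‖y‖) fun X =>
      (4⁻¹ * star z) * ⟪x' + z • y', ρ X (x' + z • y')⟫_ℂ := fun z hz => by
    refine ((h _ (D.add_mem hx' (D.smul_mem z hy'))).const_mul (4⁻¹ * star z)).mono ?_
    have h1 : ‖x' + z • y'‖ ≤ ‖x'‖ + ‖y'‖ := by
      simpa [norm_smul, hz] using norm_add_le x' (z • y')
    have h2 : ‖x' + z • y'‖ ^ 2 ≤ 4 * (‖x‖ * ‖y‖) := by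
      nlinarith [sq_nonneg (‖x'‖ - ‖y'‖), norm_nonneg (x' + z • y')]
    have h3 : ‖(4⁻¹ : ℂ) * star z‖ = 4⁻¹ := by simp [hz]
    rw [h3]
    linarith
  have hsum := (((hterm 1 (by simp)).add (hterm (-1) (by simp))).add
    (hterm (-Complex.I) (by simp))).add (hterm Complex.I (by simp))
  convert hsum.mono (le_of_eq (by ring : _ = 4 * (‖x‖ * ‖y‖))) using 2 with X
  have hT : ⟪x, ρ X y⟫_ℂ = ⟪x', ρ X y'⟫_ℂ := by
    rw [map_smul, inner_smul_left, inner_smul_right, Complex.conj_ofReal, ← mul_assoc,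
      ← Complex.ofReal_mul, mul_inv_cancel₀ ht.ne', Complex.ofReal_one, one_mul]
  rw [hT]
  simp only [map_add, map_smul, inner_add_left, inner_add_right, inner_smul_left, inner_smul_right,
    map_neg, map_one, Complex.conj_I, Complex.star_def]
  linear_combination ((1 / 2 : ℂ) * ⟪x', ρ X y'⟫_ℂ - (1 / 2 : ℂ) * ⟪y', ρ X x'⟫_ℂ) * Complex.I_sq

/-- Normality of a linear family of operators follows from a norm estimate of its vector
functionals on a dense subspace. -/
theorem isNormalMap_of_isNuclear {N : VonNeumannAlgebra K} {D : Submodule ℂ K}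
    (hD : Dense (D : Set K)) {ρ : M.toStarSubalgebra → N.toStarSubalgebra}
    (h : ∀ x ∈ D, IsNuclear M (‖x‖ ^ 2) fun X => ⟪x, (ρ X : K →L[ℂ] K) x⟫_ℂ) :
    IsNormalMap M N ρ := by
  -- Expanding a vector in a series from `D` costs a factor 3 for each argument: 4 becomes 12 here
  -- and 36 in `h2`.
  have h1 : ∀ x ∈ D, ∀ y, IsNuclear M (12 * (‖x‖ * ‖y‖))
      fun X => ⟪x, (ρ X : K →L[ℂ] K) y⟫_ℂ := fun x hx y => by
    obtain ⟨v, hvD, hv, hvs, hle⟩ := exists_hasSum_of_mem_closure hD y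
    have hsum := IsNuclear.hasSum (g := fun X => ⟪x, (ρ X : K →L[ℂ] K) y⟫_ℂ)
      (fun n => IsNuclear.polarize (ρ := fun X => (ρ X : K →L[ℂ] K)) h hx (hvD n))
      ((hvs.mul_left ‖x‖).mul_left 4)
      (fun X => (innerSL ℂ x ∘L (ρ X : K →L[ℂ] K)).hasSum hv)
    refine hsum.mono ?_
    rw [tsum_mul_left, tsum_mul_left]
    nlinarith [mul_le_mul_of_nonneg_left hle (norm_nonneg x)]
  have h2 : ∀ x y, IsNuclear M (36 * (‖x‖ * ‖y‖))
      fun X => ⟪x, (ρ X : K →L[ℂ] K) y⟫_ℂ := fun x y => by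
    obtain ⟨v, hvD, hv, hvs, hle⟩ := exists_hasSum_of_mem_closure hD x
    have hsum := IsNuclear.hasSum (g := fun X => ⟪x, (ρ X : K →L[ℂ] K) y⟫_ℂ)
      (fun n => h1 (v n) (hvD n) y) ((hvs.mul_right ‖y‖).mul_left 12)
      (fun X => by
        have h3 := (innerSL ℂ ((ρ X : K →L[ℂ] K) y)).hasSum hv
        have h4 := (Complex.conjCLE : ℂ →L[ℝ] ℂ).hasSum h3
        simpa [inner_conj_symm, Function.comp_def] using h4)
    refine hsum.mono ?_
    rw [tsum_mul_left, tsum_mul_right]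
    nlinarith [mul_le_mul_of_nonneg_right hle (norm_nonneg y)]
  refine isNormalMap_of_forall fun ξ η hξ hη => ?_
  have hs : Summable fun n => ‖ξ n‖ * ‖η n‖ :=
    Summable.of_nonneg_of_le (fun n => by positivity)
      (fun n => by nlinarith [sq_nonneg (‖ξ n‖ - ‖η n‖), sq_nonneg ‖ξ n‖, sq_nonneg ‖η n‖])
      (hξ.add hη)
  refine (IsNuclear.hasSum (fun n => h2 (ξ n) (η n)) (hs.mul_left 36)
    fun X => ?_).isNormalFunctional
  exact (Summable.of_norm_bounded (hs.mul_left ‖(ρ X : K →L[ℂ] K)‖)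
    fun n => norm_inner_apply_le _ _ _).hasSum

end Nuclear

/-! ### Normal homomorphisms constructed from the commutants -/

section DualEmbedding

variable {H : Type*} [NormedAddCommGroup H] [InnerProductSpace ℂ H] [CompleteSpace H]
variable {K : Type*} [NormedAddCommGroup K] [InnerProductSpace ℂ K] [CompleteSpace K]

theorem VonNeumannAlgebra.mem_of_commute {N : VonNeumannAlgebra K} {X : K →L[ℂ] K}
    (h : ∀ y ∈ N.commutant, X * y = y * X) : X ∈ N := by
  rw [← N.commutant_commutant, VonNeumannAlgebra.mem_commutant_iff]
  exact fun y hy => (h y hy).symm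

theorem VonNeumannAlgebra.commute_of_mem {N : VonNeumannAlgebra K} {X y : K →L[ℂ] K}
    (hX : X ∈ N) (hy : y ∈ N.commutant) : X * y = y * X :=
  VonNeumannAlgebra.mem_commutant_iff.1 hy X hX

theorem VonNeumannAlgebra.commute_adjoint_comp {M : VonNeumannAlgebra H}
    {N : VonNeumannAlgebra K} {Z : H →L[ℂ] K}
    (hZ : ∀ y ∈ N.commutant, adjoint Z ∘L y ∘L Z ∈ M.commutant) {X : H →L[ℂ] H} (hX : X ∈ M)
    {y : K →L[ℂ] K} (hy : y ∈ N.commutant) : Commute X (adjoint (y ∘L Z) ∘L (y ∘L Z)) := by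
  have h1 := hZ _ (mul_mem (star_mem hy) hy)
  rw [adjoint_comp, ContinuousLinearMap.comp_assoc]
  exact VonNeumannAlgebra.commute_of_mem hX h1

/-- Elements of a von Neumann algebra are determined by their values at a vector which is cyclic
for the commutant. -/
theorem IsCyclicVector.eq_of_mem {N : VonNeumannAlgebra K} {Ω : K}
    (h : IsCyclicVector (N.commutant : Set (K →L[ℂ] K)) Ω) {X Y : K →L[ℂ] K} (hX : X ∈ N)
    (hY : Y ∈ N) (hXY : X Ω = Y Ω) : X = Y :=
  h.eq_of_apply_eq (fun _ hy => VonNeumannAlgebra.commute_of_mem hX hy)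
    (fun _ hy => VonNeumannAlgebra.commute_of_mem hY hy) hXY

/-- An operator `Z` which compresses `N'` into `M'` and intertwines `M'` with `N'` gives rise
to a normal homomorphism `i : M → N` with `i(X) Z = Z X`. -/
theorem exists_normal_starAlgHom {M : VonNeumannAlgebra H} {N : VonNeumannAlgebra K} {Ω : H}
    {Z : H →L[ℂ] K} (hM : IsCyclicVector (M.commutant : Set (H →L[ℂ] H)) Ω)
    (hN : IsCyclicVector (N.commutant : Set (K →L[ℂ] K)) (Z Ω))
    (hZ : ∀ y ∈ N.commutant, adjoint Z ∘L y ∘L Z ∈ M.commutant)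
    (hJ : ∀ y ∈ M.commutant, ∃ J ∈ N.commutant, ∀ h, J (Z h) = Z (y h)) :
    ∃ i : M.toStarSubalgebra →⋆ₐ[ℂ] N.toStarSubalgebra, IsNormalMap M N i ∧
      ∀ X h, (i X : K →L[ℂ] K) (Z h) = Z ((X : H →L[ℂ] H) h) := by
  have hex : ∀ X : M.toStarSubalgebra, ∃ R : N.toStarSubalgebra,
      (R : K →L[ℂ] K) (Z Ω) = Z ((X : H →L[ℂ] H) Ω) := fun X => by
    let T : (K →L[ℂ] K) →ₗ[ℂ] K :=
      { toFun := fun y => y (Z ((X : H →L[ℂ] H) Ω))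
        map_add' := fun _ _ => rfl
        map_smul' := fun _ _ => rfl }
    obtain ⟨R, hR⟩ := IsCyclicVector.exists_extension (B := N.commutant.toStarSubalgebra) hN T
      ‖(X : H →L[ℂ] H)‖ fun y hy => norm_apply_le_of_commute (T := y ∘L Z)
        (VonNeumannAlgebra.commute_adjoint_comp hZ X.2 hy) Ω
    have hRN : R ∈ N := VonNeumannAlgebra.mem_of_commute fun y hy => hN.ext fun z hz => by
      have h1 : R (y (z (Z Ω))) = y (z (Z ((X : H →L[ℂ] H) Ω))) := hR (y * z) (mul_mem hy hz)
      have h2 : R (z (Z Ω)) = z (Z ((X : H →L[ℂ] H) Ω)) := hR z hz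
      change R (y (z (Z Ω))) = y (R (z (Z Ω)))
      rw [h1, h2]
    exact ⟨⟨R, hRN⟩, by simpa [T] using hR 1 (one_mem _)⟩
  -- From here on `i X` is pinned down by its value at `Z Ω`, which is separating for `N`; the
  -- algebraic identities except the one for the adjoint are then read off at this vector.
  choose i hi using hex
  have hcomm : ∀ X, ∀ y ∈ N.commutant, ∀ k, (i X : K →L[ℂ] K) (y k) = y ((i X : K →L[ℂ] K) k) :=
    fun X y hy k => congrArg (fun S : K →L[ℂ] K => S k)
      (VonNeumannAlgebra.commute_of_mem (i X).2 hy)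
  have huniq : ∀ (X : M.toStarSubalgebra) (R : N.toStarSubalgebra),
      (R : K →L[ℂ] K) (Z Ω) = Z ((X : H →L[ℂ] H) Ω) → i X = R := fun X R hR =>
    Subtype.ext (hN.eq_of_mem (i X).2 R.2 ((hi X).trans hR.symm))
  have hiZ : ∀ X h, (i X : K →L[ℂ] K) (Z h) = Z ((X : H →L[ℂ] H) h) := fun X => by
    -- Only the value at `Z Ω` is known so far. The lift `J` of `y` moves it to `Z y Ω`, and the
    -- vectors `y Ω` with `y ∈ M′` are total.
    have h1 : (i X : K →L[ℂ] K) ∘L Z = Z ∘L (X : H →L[ℂ] H) := hM.ext fun y hy => by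
      obtain ⟨J, hJN, hJZ⟩ := hJ y hy
      have h2 : (X : H →L[ℂ] H) (y Ω) = y ((X : H →L[ℂ] H) Ω) :=
        congrArg (fun S : H →L[ℂ] H => S Ω) (VonNeumannAlgebra.commute_of_mem X.2 hy)
      change (i X : K →L[ℂ] K) (Z (y Ω)) = Z ((X : H →L[ℂ] H) (y Ω))
      rw [← hJZ, hcomm X J hJN, hi, hJZ, h2]
    exact fun h => congrArg (fun S : H →L[ℂ] K => S h) h1
  have hcompr : ∀ X : M.toStarSubalgebra, ∀ y ∈ N.commutant, ∀ w,
      ⟪w, adjoint Z (y (Z ((X : H →L[ℂ] H) Ω)))⟫_ℂ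
        = ⟪w, (X : H →L[ℂ] H) (adjoint Z (y (Z Ω)))⟫_ℂ := fun X y hy w => by
    have h1 := congrArg (fun S : H →L[ℂ] H => S Ω)
      (VonNeumannAlgebra.commute_of_mem X.2 (hZ y hy))
    exact congrArg (fun v => ⟪w, v⟫_ℂ) h1.symm
  have hstar : ∀ X, i (star X) = star (i X) := fun X => by
    refine huniq _ _ ?_
    rw [← sub_eq_zero, ← inner_self_eq_zero (𝕜 := ℂ)]
    set w := ((star (i X) : N.toStarSubalgebra) : K →L[ℂ] K) (Z Ω)
      - Z (((star X : M.toStarSubalgebra) : H →L[ℂ] H) Ω) with hw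
    have h1 : innerSL ℂ w = 0 := hN.ext fun y hy => by
      change ⟪w, y (Z Ω)⟫_ℂ = 0
      rw [hw, inner_sub_left, StarMemClass.coe_star, StarMemClass.coe_star, star_eq_adjoint,
        star_eq_adjoint, adjoint_inner_left, hcomm X y hy, hi,
        ← adjoint_inner_right Z ((adjoint _) Ω),
        adjoint_inner_left, ← adjoint_inner_right, hcompr X y hy, sub_self]
    exact congrArg (fun S : K →L[ℂ] ℂ => S w) h1
  let φ : M.toStarSubalgebra →⋆ₐ[ℂ] N.toStarSubalgebra :=
    { toFun := i
      map_one' := huniq _ _ rfl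
      map_mul' := fun X Y => huniq _ _ (by
        change (i X : K →L[ℂ] K) ((i Y : K →L[ℂ] K) (Z Ω)) = _
        rw [hi, hiZ]
        rfl)
      map_zero' := huniq _ _ (by simp)
      map_add' := fun X Y => huniq _ _ (by
        change (i X : K →L[ℂ] K) (Z Ω) + (i Y : K →L[ℂ] K) (Z Ω) = _
        rw [hi, hi, ← map_add]
        rfl)
      commutes' := fun r => huniq _ _ (by
        simp [Algebra.algebraMap_eq_smul_one])
      map_star' := hstar }
  refine ⟨φ, ?_, hiZ⟩
  refine isNormalMap_of_isNuclear
    (IsCyclicVector.dense_map (B := N.commutant.toStarSubalgebra) hN) ?_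
  rintro _ ⟨y, hy', rfl⟩
  have hy : y ∈ N.commutant := hy'
  change IsNuclear M (‖y (Z Ω)‖ ^ 2) fun X => ⟪y (Z Ω), (i X : K →L[ℂ] K) (y (Z Ω))⟫_ℂ
  -- With `R = |yZ|`, which commutes with `X`, the functional at `y Z Ω` becomes `X ↦ ⟨R Ω, X R Ω⟩`:
  -- a vector functional on `M` with the same norm bound `‖R Ω‖² = ‖y Z Ω‖²`.
  obtain ⟨R, hR, hTR, hRcomm⟩ := exists_modulus (y ∘L Z)
  have hTR' : ∀ h, adjoint Z (adjoint y (y (Z h))) = R (R h) := fun h => by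
    have := congrArg (fun S : H →L[ℂ] H => S h) hTR
    rwa [adjoint_comp] at this
  have h1 : ∀ h, ⟪y (Z Ω), y (Z h)⟫_ℂ = ⟪R Ω, R h⟫_ℂ := fun h => by
    rw [← adjoint_inner_right y, ← adjoint_inner_right Z, hTR', ← hR, star_eq_adjoint,
      adjoint_inner_right]
    rw [← star_eq_adjoint, hR]
  have h2 : ‖y (Z Ω)‖ ^ 2 = ‖R Ω‖ * ‖R Ω‖ := by
    have h3 := h1 Ω
    rw [inner_self_eq_norm_sq_to_K, inner_self_eq_norm_sq_to_K] at h3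
    have h4 : ‖y (Z Ω)‖ ^ 2 = ‖R Ω‖ ^ 2 := by exact_mod_cast h3
    rw [h4, sq]
  rw [h2]
  convert isNuclear_inner (M := M) (R Ω) (R Ω) using 2 with X
  have h5 : Commute (X : H →L[ℂ] H) R := hRcomm _ 
    (VonNeumannAlgebra.commute_adjoint_comp hZ X.2 hy)
  rw [hcomm X y hy, hi, h1]
  exact congrArg (fun S : H →L[ℂ] H => ⟪R Ω, S Ω⟫_ℂ) h5.symm.eq

end DualEmbedding

/-! ### Completely positive maps and their multiplicative domain -/

section MultiplicativeDomain

variable {A : Type*} [CStarAlgebra A] [PartialOrder A] [StarOrderedRing A]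
variable {H : Type*} [NormedAddCommGroup H] [InnerProductSpace ℂ H] [CompleteSpace H]

/-- The positive matrix `Ψ(aᵢ* aⱼ)` factorizes. -/
theorem CompletelyPositiveMap.exists_factorization (Ψ : A →CP A) {n : ℕ} (a : Fin (n + 1) → A) :
    ∃ (κ : Type) (_ : Fintype κ) (b : κ → Fin (n + 1) → A),
      ∀ i j, Ψ (star (a i) * a j) = ∑ k, star (b k i) * b k j := by
  -- The matrix with first row `a` and zeros below, so that `N* N = (aᵢ* aⱼ)`. A nonnegative matrix
  -- lies in the additive monoid generated by the squares `B* B`, which gives the finite sum.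
  let N : CStarMatrix (Fin (n + 1)) (Fin (n + 1)) A :=
    CStarMatrix.ofMatrix fun k j => if k = 0 then a j else 0
  have hNk : ∀ k j, N k j = if k = 0 then a j else 0 := fun _ _ => rfl
  have hN : ∀ i j, (star N * N) i j = star (a i) * a j := fun i j => by
    rw [CStarMatrix.mul_apply, Finset.sum_eq_single 0]
    · simp [CStarMatrix.star_apply, hNk]
    · intro k _ hk
      simp [CStarMatrix.star_apply, hNk, hk]
    · simp
  have hmem := StarOrderedRing.nonneg_iff.1
    (Ψ.map_cstarMatrix_nonneg _ (star_mul_self_nonneg N))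
  have hfact : ∀ T ∈ AddSubmonoid.closure (Set.range fun s :
      CStarMatrix (Fin (n + 1)) (Fin (n + 1)) A => star s * s),
      ∃ (κ : Type) (_ : Fintype κ) (b : κ → Fin (n + 1) → A),
        ∀ i j, T i j = ∑ k, star (b k i) * b k j := fun T hT => by
    induction hT using AddSubmonoid.closure_induction with
    | mem x hx =>
      obtain ⟨B, rfl⟩ := hx
      refine ⟨Fin (n + 1), inferInstance, fun k j => B k j, fun i j => ?_⟩
      simp [CStarMatrix.mul_apply, CStarMatrix.star_apply]
    | zero => exact ⟨Empty, inferInstance, fun k => k.elim, fun i j => by simp⟩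
    | add x y _ _ hx hy =>
      obtain ⟨κ, _, b, hb⟩ := hx
      obtain ⟨κ', _, b', hb'⟩ := hy
      refine ⟨κ ⊕ κ', inferInstance, Sum.elim b b', fun i j => ?_⟩
      simp [hb, hb']
  obtain ⟨κ, hκ, b, hb⟩ := hfact _ hmem
  refine ⟨κ, hκ, b, fun i j => ?_⟩
  rw [← hb, CStarMatrix.map_apply, hN]

theorem inner_star_mul_apply (X Y : H →L[ℂ] H) (x y : H) :
    ⟪x, (star X * Y) y⟫_ℂ = ⟪X x, Y y⟫_ℂ :=
  adjoint_inner_right X x (Y y)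

/-- Elements on which `Ψ` is isometrically multiplicative belong to its multiplicative domain. -/
theorem map_mul_of_map_star_mul_self (Ψ : A →CP A) (hΨ : Ψ 1 = 1) (π : A →⋆ₐ[ℂ] (H →L[ℂ] H))
    {b c : A} (h : π (Ψ b) = π c) (h' : π (Ψ (star b)) = π (star c))
    (hb : π (Ψ (star b * b)) = π (star c * c)) (a : A) :
    π (Ψ (a * b)) = π (Ψ a) * π c := by
  -- The factorization replaces a Stinespring dilation. The hypotheses say that the vectors indexed
  -- by `b` at `ξ` and by `1` at `π(c)ξ` have squared distance 0; pairing their difference with the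
  -- vectors indexed by `a*` gives the claim.
  obtain ⟨κ, _, B, hB⟩ := Ψ.exists_factorization ![b, 1, star a]
  have hG : ∀ i j x y, ∑ k, ⟪π (B k i) x, π (B k j) y⟫_ℂ
      = ⟪x, π (Ψ (star (![b, 1, star a] i) * ![b, 1, star a] j)) y⟫_ℂ := fun i j x y => by
    rw [hB, map_sum, sum_apply, inner_sum]
    refine Finset.sum_congr rfl fun k _ => ?_
    rw [map_mul, map_star, inner_star_mul_apply]
  ext ξ
  set u : κ → H := fun k => π (B k 0) ξ - π (B k 1) (π c ξ) with hu
  have h00 : ∑ k, ⟪π (B k 0) ξ, π (B k 0) ξ⟫_ℂ = ⟪π c ξ, π c ξ⟫_ℂ := by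
    refine (hG 0 0 ξ ξ).trans ?_
    change ⟪ξ, π (Ψ (star b * b)) ξ⟫_ℂ = _
    rw [hb, map_mul, map_star, inner_star_mul_apply]
  have h01 : ∑ k, ⟪π (B k 0) ξ, π (B k 1) (π c ξ)⟫_ℂ = ⟪π c ξ, π c ξ⟫_ℂ := by
    refine (hG 0 1 ξ (π c ξ)).trans ?_
    change ⟪ξ, π (Ψ (star b * 1)) (π c ξ)⟫_ℂ = _
    rw [mul_one, h', map_star, star_eq_adjoint, adjoint_inner_right]
  have h10 : ∑ k, ⟪π (B k 1) (π c ξ), π (B k 0) ξ⟫_ℂ = ⟪π c ξ, π c ξ⟫_ℂ := by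
    refine (hG 1 0 (π c ξ) ξ).trans ?_
    change ⟪π c ξ, π (Ψ (star 1 * b)) ξ⟫_ℂ = _
    rw [star_one, one_mul, h]
  have h11 : ∑ k, ⟪π (B k 1) (π c ξ), π (B k 1) (π c ξ)⟫_ℂ = ⟪π c ξ, π c ξ⟫_ℂ := by
    refine (hG 1 1 (π c ξ) (π c ξ)).trans ?_
    change ⟪π c ξ, π (Ψ (star 1 * 1)) (π c ξ)⟫_ℂ = _
    rw [star_one, one_mul, hΨ, map_one]
    rfl
  have hzero : ∑ k, ⟪u k, u k⟫_ℂ = 0 := by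
    simp only [hu, inner_sub_left, inner_sub_right, Finset.sum_sub_distrib, h00, h01, h10, h11,
      sub_self]
  have hu0 : ∀ k, u k = 0 := fun k => by
    have h1 : ∑ k, ‖u k‖ ^ 2 = 0 := by
      have h2 : ((∑ k, ‖u k‖ ^ 2 : ℝ) : ℂ) = 0 := by
        rw [← hzero]
        simp [inner_self_eq_norm_sq_to_K]
      exact_mod_cast h2
    have h3 := (Finset.sum_eq_zero_iff_of_nonneg fun k _ => sq_nonneg ‖u k‖).1 h1 k
      (Finset.mem_univ k)
    exact norm_eq_zero.1 (pow_eq_zero_iff two_ne_zero |>.1 h3)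
  refine ext_inner_left ℂ fun η => ?_
  have h20 : ∑ k, ⟪π (B k 2) η, π (B k 0) ξ⟫_ℂ = ⟪η, π (Ψ (a * b)) ξ⟫_ℂ := by
    refine (hG 2 0 η ξ).trans ?_
    change ⟪η, π (Ψ (star (star a) * b)) ξ⟫_ℂ = _
    rw [star_star]
  have h21 : ∑ k, ⟪π (B k 2) η, π (B k 1) (π c ξ)⟫_ℂ = ⟪η, π (Ψ a) (π c ξ)⟫_ℂ := by
    refine (hG 2 1 η (π c ξ)).trans ?_
    change ⟪η, π (Ψ (star (star a) * 1)) (π c ξ)⟫_ℂ = _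
    rw [star_star, mul_one]
  have h2 : ∑ k, ⟪π (B k 2) η, u k⟫_ℂ = 0 := by simp [hu0]
  simp only [hu, inner_sub_right, Finset.sum_sub_distrib, h20, h21] at h2
  exact sub_eq_zero.1 h2

end MultiplicativeDomain

/-! ### The isometry `U` and the action of the adjoint map in the GNS representation -/

namespace MultiplicativeSystem

variable {A : Type*} [CStarAlgebra A] [PartialOrder A] [StarOrderedRing A]
variable (S : MultiplicativeSystem A)

theorem isCyclicVector_gnsVector :
    IsCyclicVector (S.gnsRep.range : Set (S.GNSSpace →L[ℂ] S.GNSSpace)) S.gnsVector := by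
  refine (UniformSpace.Completion.denseRange_coe (α := S.state.PreGNS)).mono ?_
  rintro _ ⟨x, rfl⟩
  refine Submodule.subset_span ⟨S.gnsRep (S.state.ofPreGNS x), ⟨_, rfl⟩, ?_⟩
  rw [S.gnsRep_gnsVector, S.state.toPreGNS_ofPreGNS]

theorem ext_gnsVector {K : Type*} [NormedAddCommGroup K] [InnerProductSpace ℂ K] [CompleteSpace K]
    {X Y : S.GNSSpace →L[ℂ] K}
    (h : ∀ a, X (S.gnsRep a S.gnsVector) = Y (S.gnsRep a S.gnsVector)) : X = Y := by
  refine S.isCyclicVector_gnsVector.ext ?_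
  rintro _ ⟨a, rfl⟩
  exact h a

theorem inner_gnsRep_gnsVector (a b : A) :
    ⟪S.gnsRep a S.gnsVector, S.gnsRep b S.gnsVector⟫_ℂ = S.state (star a * b) := by
  rw [gnsRep_gnsVector, gnsRep_gnsVector, UniformSpace.Completion.inner_coe,
    PositiveLinearMap.preGNS_inner_def]
  rfl

theorem gnsRep_one_gnsVector : S.gnsRep 1 S.gnsVector = S.gnsVector := by
  rw [map_one]
  rfl

theorem norm_U_apply (h : S.GNSSpace) : ‖S.U h‖ = ‖h‖ := by
  induction h using UniformSpace.Completion.induction_on with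
  | hp => exact isClosed_eq (by fun_prop) (by fun_prop)
  | ih a =>
    simp only [U, ContinuousLinearMap.completion_apply_coe, UniformSpace.Completion.norm_coe]
    exact S.preU.norm_map a

theorem star_U_mul_U : star S.U * S.U = 1 :=
  (ContinuousLinearMap.norm_map_iff_adjoint_comp_self S.U).1 S.norm_U_apply

theorem adjoint_U_U (h : S.GNSSpace) : adjoint S.U (S.U h) = h :=
  congrArg (fun T : S.GNSSpace →L[ℂ] S.GNSSpace => T h) S.star_U_mul_U

theorem U_gnsVector : S.U S.gnsVector = S.gnsVector := by
  have h := S.U_apply 1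
  rwa [map_one S.dynamics, gnsRep_one_gnsVector] at h

theorem adjoint_U_gnsVector : adjoint S.U S.gnsVector = S.gnsVector := by
  conv_lhs => rw [← S.U_gnsVector]
  exact S.adjoint_U_U _

theorem U_gnsRep (a : A) (h : S.GNSSpace) :
    S.U (S.gnsRep a h) = S.gnsRep (S.dynamics a) (S.U h) := by
  have h1 : S.U ∘L S.gnsRep a = S.gnsRep (S.dynamics a) ∘L S.U := S.ext_gnsVector fun b => by
    change S.U (S.gnsRep a (S.gnsRep b S.gnsVector))
      = S.gnsRep (S.dynamics a) (S.U (S.gnsRep b S.gnsVector))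
    have h2 : ∀ a b h, S.gnsRep a (S.gnsRep b h) = S.gnsRep (a * b) h := fun a b h => by
      rw [map_mul]
      rfl
    rw [h2, U_apply, U_apply, h2, map_mul]
  exact congrArg (fun T : S.GNSSpace →L[ℂ] S.GNSSpace => T h) h1

/-- The adjoint of `U π_φ(a*) = π_φ(Φ(a*)) U`. -/
theorem adjoint_U_gnsRep (a : A) (h : S.GNSSpace) :
    adjoint S.U (S.gnsRep (S.dynamics a) h) = S.gnsRep a (adjoint S.U h) := by
  refine ext_inner_right ℂ fun k => ?_
  have h1 : ∀ b x y, ⟪S.gnsRep b x, y⟫_ℂ = ⟪x, S.gnsRep (star b) y⟫_ℂ := fun b x y => by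
    rw [map_star, star_eq_adjoint, adjoint_inner_right]
  rw [adjoint_inner_left, h1, ← map_star S.dynamics, ← U_gnsRep, h1, adjoint_inner_left]

variable {S} {Ψ : A →CP A}

theorem IsStateAdjoint.adjoint_U_apply (hΨ : S.IsStateAdjoint Ψ) (b : A) :
    adjoint S.U (S.gnsRep b S.gnsVector) = S.gnsRep (Ψ b) S.gnsVector := by
  rw [← sub_eq_zero, ← inner_self_eq_zero (𝕜 := ℂ)]
  set w := adjoint S.U (S.gnsRep b S.gnsVector) - S.gnsRep (Ψ b) S.gnsVector with hw
  have h1 : innerSL ℂ w = 0 := S.ext_gnsVector fun a => by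
    change ⟪w, S.gnsRep a S.gnsVector⟫_ℂ = 0
    rw [← inner_conj_symm, hw, inner_sub_right, adjoint_inner_right, U_apply,
      inner_gnsRep_gnsVector, inner_gnsRep_gnsVector, hΨ.adjoint_eq, map_star, sub_self, map_zero]
  exact congrArg (fun T : S.GNSSpace →L[ℂ] ℂ => T w) h1

theorem gnsRep_eq_of_apply_eq
    (hcyclic : IsCyclicVector (Set.centralizer (Set.range S.gnsRep)) S.gnsVector) {a b : A}
    (h : S.gnsRep a S.gnsVector = S.gnsRep b S.gnsVector) : S.gnsRep a = S.gnsRep b :=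
  hcyclic.eq_of_apply_eq (fun _ hy => hy _ ⟨a, rfl⟩) (fun _ hy => hy _ ⟨b, rfl⟩) h

/-- At `Ω_φ` this is `U* U = 1`, and `Ω_φ` is separating. Applied to `b`, `b*` and `b* b` it places
`Φ(b)` in the multiplicative domain of `π_φ ∘ Φ♯`. -/
theorem IsStateAdjoint.gnsRep_dynamics (hΨ : S.IsStateAdjoint Ψ)
    (hcyclic : IsCyclicVector (Set.centralizer (Set.range S.gnsRep)) S.gnsVector) (b : A) :
    S.gnsRep (Ψ (S.dynamics b)) = S.gnsRep b := by
  refine gnsRep_eq_of_apply_eq hcyclic ?_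
  rw [← hΨ.adjoint_U_apply, ← U_apply, adjoint_U_U]

/-- `U* π_φ(a) U = π_φ(Φ♯(a))`. -/
theorem IsStateAdjoint.adjoint_U_gnsRep_U (hΨ : S.IsStateAdjoint Ψ)
    (hcyclic : IsCyclicVector (Set.centralizer (Set.range S.gnsRep)) S.gnsVector) (a : A)
    (h : S.GNSSpace) : adjoint S.U (S.gnsRep a (S.U h)) = S.gnsRep (Ψ a) h := by
  have h1 : adjoint S.U ∘L S.gnsRep a ∘L S.U = S.gnsRep (Ψ a) := S.ext_gnsVector fun b => by
    change adjoint S.U (S.gnsRep a (S.U (S.gnsRep b S.gnsVector))) = _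
    have h2 := map_mul_of_map_star_mul_self Ψ hΨ.map_one S.gnsRep
      (hΨ.gnsRep_dynamics hcyclic b)
      (by rw [← map_star S.dynamics, hΨ.gnsRep_dynamics hcyclic])
      (by rw [← map_star S.dynamics, ← map_mul S.dynamics, hΨ.gnsRep_dynamics hcyclic]) a
    have h3 := congrArg (fun T : S.GNSSpace →L[ℂ] S.GNSSpace => T S.gnsVector) h2
    refine Eq.trans ?_ h3
    rw [← hΨ.adjoint_U_apply, U_apply, map_mul]
    rfl
  exact congrArg (fun T : S.GNSSpace →L[ℂ] S.GNSSpace => T h) h1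

end MultiplicativeSystem

/-! ### The minimal unitary extension of an isometry -/

section UnitaryExtension

variable {H : Type*} [NormedAddCommGroup H] [InnerProductSpace ℂ H] [CompleteSpace H]

theorem lp.hasSum_norm_sq (x : lp (fun _ : ℕ => H) 2) :
    HasSum (fun n => ‖x n‖ ^ 2) (‖x‖ ^ 2) := by
  have h := lp.hasSum_norm (p := 2) (by norm_num) x
  simpa using h

/-- The sequence `(U* x₀, x₀ - U U* x₀, x₁, x₂, …)`. -/
def dilationShiftFun (U : H →L[ℂ] H) (x : ℕ → H) : ℕ → H
  | 0 => adjoint U (x 0)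
  | 1 => x 0 - U (adjoint U (x 0))
  | n + 2 => x (n + 1)

theorem norm_sq_adjoint_add {U : H →L[ℂ] H} (hU : star U * U = 1) (h : H) :
    ‖adjoint U h‖ ^ 2 + ‖h - U (adjoint U h)‖ ^ 2 = ‖h‖ ^ 2 := by
  have h1 : ‖U (adjoint U h)‖ = ‖adjoint U h‖ :=
    (ContinuousLinearMap.norm_map_iff_adjoint_comp_self U).2 hU _
  have h2 : ⟪U (adjoint U h), h - U (adjoint U h)⟫_ℂ = 0 := by
    rw [← adjoint_inner_right, map_sub,
      show adjoint U (U (adjoint U h)) = adjoint U h from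
        congrArg (fun T : H →L[ℂ] H => T (adjoint U h)) hU, sub_self, inner_zero_right]
  have h3 := norm_add_sq_eq_norm_sq_add_norm_sq_of_inner_eq_zero _ _ h2
  rw [add_sub_cancel, h1] at h3
  rw [sq, sq, sq, h3]

theorem dilationShiftFun_add (U : H →L[ℂ] H) (x y : ℕ → H) :
    dilationShiftFun U (x + y) = dilationShiftFun U x + dilationShiftFun U y := by
  funext n
  match n with
  | 0 => simp [dilationShiftFun]
  | 1 =>
    simp only [dilationShiftFun, Pi.add_apply, map_add]
    abel
  | n + 2 => simp [dilationShiftFun]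

theorem dilationShiftFun_smul (U : H →L[ℂ] H) (c : ℂ) (x : ℕ → H) :
    dilationShiftFun U (c • x) = c • dilationShiftFun U x := by
  funext n
  match n with
  | 0 => simp [dilationShiftFun]
  | 1 => simp [dilationShiftFun, smul_sub]
  | n + 2 => simp [dilationShiftFun]

theorem hasSum_norm_sq_dilationShiftFun {U : H →L[ℂ] H} (hU : star U * U = 1)
    {x : ℕ → H} {c : ℝ} (hx : HasSum (fun n => ‖x n‖ ^ 2) c) :
    HasSum (fun n => ‖dilationShiftFun U x n‖ ^ 2) c := by
  have h1 := (hasSum_nat_add_iff' 1).2 hx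
  rw [Finset.sum_range_one] at h1
  have h3 := (hasSum_nat_add_iff (f := fun n => ‖dilationShiftFun U x n‖ ^ 2) 2).1 h1
  rw [Finset.sum_range_succ, Finset.sum_range_one] at h3
  simp only [dilationShiftFun] at h3
  rwa [norm_sq_adjoint_add hU, sub_add_cancel] at h3

/-- The isometry `x ↦ (U* x₀, x₀ - U U* x₀, x₁, x₂, …)` of `ℓ²(ℕ, H)`. -/
def dilationShift (U : H →L[ℂ] H) (hU : star U * U = 1) :
    lp (fun _ : ℕ => H) 2 →ₗᵢ[ℂ] lp (fun _ : ℕ => H) 2 where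
  toFun x := ⟨dilationShiftFun U x, memℓp_gen
    (by simpa using (hasSum_norm_sq_dilationShiftFun hU (lp.hasSum_norm_sq x)).summable)⟩
  map_add' x y := Subtype.ext (dilationShiftFun_add U x y)
  map_smul' c x := Subtype.ext (dilationShiftFun_smul U c x)
  norm_map' x := by
    refine (pow_left_inj₀ (norm_nonneg _) (norm_nonneg _) two_ne_zero).1 ?_
    exact (lp.hasSum_norm_sq _).unique (hasSum_norm_sq_dilationShiftFun hU (lp.hasSum_norm_sq x))

variable (U : H →L[ℂ] H) (hU : star U * U = 1)

/-- The space `H ⊕ ker U* ⊕ ker U* ⊕ …` of the minimal unitary extension of the isometry `U`. -/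
def unitaryExtensionSpace : Submodule ℂ (lp (fun _ : ℕ => H) 2) where
  carrier := {x | ∀ n, adjoint U (x (n + 1)) = 0}
  add_mem' hx hy n := by simp [hx n, hy n]
  zero_mem' n := by simp
  smul_mem' c x hx n := by simp [hx n]

theorem isClosed_unitaryExtensionSpace :
    IsClosed (unitaryExtensionSpace U : Set (lp (fun _ : ℕ => H) 2)) := by
  have h : (unitaryExtensionSpace U : Set (lp (fun _ : ℕ => H) 2))
      = ⋂ n : ℕ, {x | adjoint U (x (n + 1)) = 0} := by
    ext x
    simp [unitaryExtensionSpace]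
  rw [h]
  refine isClosed_iInter fun n => isClosed_eq ?_ continuous_const
  refine (adjoint U).continuous.comp ?_
  exact (lp.evalCLM ℂ (fun _ : ℕ => H) 2 (n + 1)).continuous

instance : CompleteSpace (unitaryExtensionSpace U) :=
  (isClosed_unitaryExtensionSpace U).completeSpace_coe

/-- The inverse of the minimal unitary extension of `U`. -/
def unitaryExtensionInv : unitaryExtensionSpace U →L[ℂ] unitaryExtensionSpace U :=
  ((dilationShift U hU).toContinuousLinearMap ∘L (unitaryExtensionSpace U).subtypeL).codRestrict _
    fun x n => by
      change adjoint U (dilationShiftFun U x.1 (n + 1)) = 0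
      match n with
      | 0 =>
        have h : adjoint U (U (adjoint U (x.1 0))) = adjoint U (x.1 0) :=
          congrArg (fun T : H →L[ℂ] H => T (adjoint U (x.1 0))) hU
        simp [dilationShiftFun, h]
      | n + 1 => exact x.2 n

/-- The inclusion `h ↦ (h, 0, 0, …)`. -/
def unitaryExtensionIncl : H →L[ℂ] unitaryExtensionSpace U :=
  LinearMap.mkContinuous
    { toFun := fun h => ⟨lp.single (E := fun _ : ℕ => H) 2 0 h, fun n => by
        rw [lp.single_apply_ne _ _ _ (Nat.succ_ne_zero n), map_zero]⟩
      map_add' := fun x y => Subtype.ext (lp.single_add (E := fun _ : ℕ => H) 2 0 x y)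
      map_smul' := fun c x => Subtype.ext
        (lp.single_smul (E := fun _ : ℕ => H) 2 0 c x) } 1
    fun h => by
      rw [one_mul]
      exact (lp.norm_single (E := fun _ : ℕ => H) (p := 2) two_pos 0 h).le

variable {U}

theorem unitaryExtensionInv_apply (x : unitaryExtensionSpace U) (n : ℕ) :
    (unitaryExtensionInv U hU x).1 n = dilationShiftFun U x.1 n := rfl

theorem norm_unitaryExtensionInv (x : unitaryExtensionSpace U) :
    ‖unitaryExtensionInv U hU x‖ = ‖x‖ := (dilationShift U hU).norm_map x.1

theorem norm_unitaryExtensionIncl (h : H) : ‖unitaryExtensionIncl U h‖ = ‖h‖ :=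
  lp.norm_single (E := fun _ : ℕ => H) (p := 2) two_pos 0 h

theorem unitaryExtensionIncl_val (h : H) :
    (unitaryExtensionIncl U h).1 = lp.single (E := fun _ : ℕ => H) 2 0 h := rfl

theorem inner_unitaryExtensionIncl (h : H) (x : unitaryExtensionSpace U) :
    ⟪unitaryExtensionIncl U h, x⟫_ℂ = ⟪h, x.1 0⟫_ℂ :=
  lp.inner_single_left (G := fun _ : ℕ => H) 0 h x.1

theorem unitaryExtensionInv_pow_apply_zero (n : ℕ) (x : unitaryExtensionSpace U) :
    ((unitaryExtensionInv U hU ^ n) x).1 0 = (star U ^ n) (x.1 0) := by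
  induction n with
  | zero => rfl
  | succ n ih =>
    rw [pow_succ', pow_succ']
    change adjoint U (((unitaryExtensionInv U hU ^ n) x).1 0) = _
    rw [ih]
    rfl

/-- A vector of `ker U*` placed in position 0 loses its `U*` component and moves one place to the
right at each step. -/
theorem unitaryExtensionInv_pow_incl {d : H} (hd : adjoint U d = 0) (n : ℕ) :
    ((unitaryExtensionInv U hU ^ n) (unitaryExtensionIncl U d)).1
      = lp.single (E := fun _ : ℕ => H) 2 n d := by
  induction n with
  | zero => rfl
  | succ n ih =>
    ext m
    rw [pow_succ']
    change dilationShiftFun U ((unitaryExtensionInv U hU ^ n) (unitaryExtensionIncl U d)).1 m = _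
    rw [ih]
    match m, n with
    | 0, 0 => simp [dilationShiftFun, hd]
    | 0, n + 1 => simp [dilationShiftFun]
    | 1, 0 => simp [dilationShiftFun, hd]
    | 1, n + 1 => simp [dilationShiftFun]
    | m + 2, 0 => simp [dilationShiftFun]
    | m + 2, n + 1 =>
      by_cases h : m = n
      · subst h
        simp [dilationShiftFun]
      · simp [dilationShiftFun, h]

/-- Minimality of the extension: position 0 is reached with `n = 0`, and position `n + 1` by testing
against `y (n + 1)`, which lies in `ker U*` by definition of the space. -/
theorem eq_zero_of_forall_inner_unitaryExtensionInv_pow {y : unitaryExtensionSpace U}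
    (h : ∀ (n : ℕ) (x : H), ⟪(unitaryExtensionInv U hU ^ n) (unitaryExtensionIncl U x), y⟫_ℂ = 0) : y = 0 := by
  refine Subtype.ext (lp.ext (funext fun n => ?_))
  match n with
  | 0 =>
    have h1 := h 0 (y.1 0)
    rw [pow_zero] at h1
    exact inner_self_eq_zero.1 ((inner_unitaryExtensionIncl _ y).symm.trans h1)
  | n + 1 =>
    have h1 := h (n + 1) (y.1 (n + 1))
    rw [Submodule.coe_inner, unitaryExtensionInv_pow_incl hU (y.2 n), lp.inner_single_left] at h1
    exact inner_self_eq_zero.1 h1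

end UnitaryExtension

/-! ### Existence of a covariant GNS representation -/

namespace MultiplicativeSystem

variable {A : Type u} [CStarAlgebra A] [PartialOrder A] [StarOrderedRing A]
variable (S : MultiplicativeSystem A)

/-- The representations `π_φ ∘ Φⁿ`. -/
def iterRep : ℕ → A →⋆ₐ[ℂ] (S.GNSSpace →L[ℂ] S.GNSSpace)
  | 0 => S.gnsRep
  | n + 1 => (iterRep n).comp S.dynamics

theorem adjoint_U_iterRep (n : ℕ) (a : A) (h : S.GNSSpace) :
    adjoint S.U (S.iterRep (n + 1) a h) = S.iterRep n a (adjoint S.U h) := by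
  induction n generalizing a with
  | zero => exact S.adjoint_U_gnsRep a h
  | succ n ih => exact ih (S.dynamics a)

/-- The operator `π_φ(a) ⊕ π_φ(Φ(a)) ⊕ π_φ(Φ²(a)) ⊕ …` on the space of the minimal unitary
extension of `U`. -/
def extensionOp (a : A) : unitaryExtensionSpace S.U →L[ℂ] unitaryExtensionSpace S.U :=
  (lp.mapCLM (E := fun _ : ℕ => S.GNSSpace) (F := fun _ : ℕ => S.GNSSpace) 2
    (fun n => S.iterRep n a) (norm_nonneg a)
    (fun n => NonUnitalStarAlgHom.norm_apply_le (S.iterRep n) a) ∘L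
      (unitaryExtensionSpace S.U).subtypeL).codRestrict _ fun x n => by
    change adjoint S.U (S.iterRep (n + 1) a (x.1 (n + 1))) = 0
    rw [adjoint_U_iterRep, x.2 n, map_zero]

theorem extensionOp_apply (a : A) (x : unitaryExtensionSpace S.U) (n : ℕ) :
    (S.extensionOp a x).1 n = S.iterRep n a (x.1 n) := rfl

theorem extensionOp_ext {X Y : unitaryExtensionSpace S.U →L[ℂ] unitaryExtensionSpace S.U}
    (h : ∀ x n, (X x).1 n = (Y x).1 n) : X = Y :=
  ContinuousLinearMap.ext fun x => Subtype.ext (lp.ext (funext (h x)))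

/-- The representation `π_φ ⊕ π_φ ∘ Φ ⊕ π_φ ∘ Φ² ⊕ …`. -/
def extensionRep : A →⋆ₐ[ℂ] (unitaryExtensionSpace S.U →L[ℂ] unitaryExtensionSpace S.U) where
  toFun := S.extensionOp
  map_one' := S.extensionOp_ext fun x n => by
    rw [extensionOp_apply, map_one]
    rfl
  map_mul' a b := S.extensionOp_ext fun x n => by
    rw [extensionOp_apply, map_mul]
    rfl
  map_zero' := S.extensionOp_ext fun x n => by
    rw [extensionOp_apply, map_zero]
    rfl
  map_add' a b := S.extensionOp_ext fun x n => by
    rw [extensionOp_apply, map_add]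
    rfl
  commutes' r := S.extensionOp_ext fun x n => by
    rw [extensionOp_apply, Algebra.algebraMap_eq_smul_one, map_smul, map_one,
      Algebra.algebraMap_eq_smul_one]
    rfl
  map_star' a := by
    refine (eq_adjoint_iff _ _).2 fun x y => ?_
    rw [Submodule.coe_inner, Submodule.coe_inner, lp.inner_eq_tsum, lp.inner_eq_tsum]
    refine tsum_congr fun n => ?_
    rw [extensionOp_apply, extensionOp_apply, map_star, star_eq_adjoint, adjoint_inner_left]

theorem extensionRep_incl (a : A) (h : S.GNSSpace) :
    S.extensionRep a (unitaryExtensionIncl S.U h) = unitaryExtensionIncl S.U (S.gnsRep a h) := by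
  refine Subtype.ext (lp.ext (funext fun n => ?_))
  change S.iterRep n a ((unitaryExtensionIncl S.U h).1 n) = _
  rw [unitaryExtensionIncl_val, unitaryExtensionIncl_val]
  match n with
  | 0 => simp [iterRep]
  | n + 1 => simp

/-- Positions 0 and 1 use that `U` and `U*` intertwine `π_φ` and `π_φ ∘ Φ`. In later positions the
shift by one place is matched by one more application of `Φ`. -/
theorem extensionRep_mul_unitaryExtensionInv (a : A) :
    S.extensionRep a * unitaryExtensionInv S.U S.star_U_mul_U
      = unitaryExtensionInv S.U S.star_U_mul_U * S.extensionRep (S.dynamics a) := by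
  refine S.extensionOp_ext fun x n => ?_
  change S.iterRep n a (dilationShiftFun S.U x.1 n)
    = dilationShiftFun S.U (S.extensionOp (S.dynamics a) x).1 n
  match n with
  | 0 => exact (S.adjoint_U_gnsRep a _).symm
  | 1 =>
    change S.gnsRep (S.dynamics a) (x.1 0 - S.U (adjoint S.U (x.1 0)))
      = S.gnsRep (S.dynamics a) (x.1 0) - S.U (adjoint S.U (S.gnsRep (S.dynamics a) (x.1 0)))
    rw [map_sub, adjoint_U_gnsRep, U_gnsRep]
  | n + 2 => rfl

theorem unitaryExtensionInv_gnsVector :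
    unitaryExtensionInv S.U S.star_U_mul_U (unitaryExtensionIncl S.U S.gnsVector)
      = unitaryExtensionIncl S.U S.gnsVector := by
  refine Subtype.ext (lp.ext (funext fun n => ?_))
  rw [unitaryExtensionInv_apply, unitaryExtensionIncl_val]
  match n with
  | 0 => simp [dilationShiftFun, S.adjoint_U_gnsVector]
  | 1 => simp [dilationShiftFun, S.adjoint_U_gnsVector, S.U_gnsVector]
  | n + 2 => simp [dilationShiftFun]

theorem isCyclicVector_unitaryExtensionIncl_gnsVector :
    IsCyclicVector (translatesAlgebra S.extensionRep (unitaryExtensionInv S.U S.star_U_mul_U) :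
      Set (unitaryExtensionSpace S.U →L[ℂ] unitaryExtensionSpace S.U))
      (unitaryExtensionIncl S.U S.gnsVector) := by
  set V := unitaryExtensionInv S.U S.star_U_mul_U with hV
  set Z := unitaryExtensionIncl S.U with hZ
  have hVV : star V * V = 1 := (ContinuousLinearMap.norm_map_iff_adjoint_comp_self V).1
    (norm_unitaryExtensionInv S.star_U_mul_U)
  have hstar : star V (Z S.gnsVector) = Z S.gnsVector := by
    conv_lhs => rw [← S.unitaryExtensionInv_gnsVector]
    exact congrArg (fun T : unitaryExtensionSpace S.U →L[ℂ] unitaryExtensionSpace S.U =>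
      T (Z S.gnsVector)) hVV
  have hpow : ∀ n : ℕ, (star V ^ n) (Z S.gnsVector) = Z S.gnsVector := fun n => by
    induction n with
    | zero => rfl
    | succ n ih =>
      rw [pow_succ]
      change (star V ^ n) (star V (Z S.gnsVector)) = _
      rw [hstar, ih]
  rw [IsCyclicVector, Submodule.dense_iff_topologicalClosure_eq_top,
    Submodule.topologicalClosure_eq_top_iff, Submodule.eq_bot_iff]
  intro y hy
  refine eq_zero_of_forall_inner_unitaryExtensionInv_pow S.star_U_mul_U fun n => ?_
  -- As `V*` fixes the vector, `Vⁿ π(a) V*ⁿ` sends it to `Vⁿ Z π_φ(a) Ω_φ`; thus orthogonality to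
  -- the orbit gives orthogonality to all `Vⁿ Z H_φ`.
  have h1 : innerSL ℂ y ∘L (V ^ n) ∘L Z = 0 := S.ext_gnsVector fun a => by
    change ⟪y, (V ^ n) (Z (S.gnsRep a S.gnsVector))⟫_ℂ = 0
    have h2 := (Submodule.mem_orthogonal' _ _).1 hy _ (Submodule.subset_span
      ⟨V ^ n * S.extensionRep a * star V ^ n, StarAlgebra.subset_adjoin ℂ _ ⟨n, a, rfl⟩, rfl⟩)
    change ⟪y, (V ^ n) (S.extensionRep a ((star V ^ n) (Z S.gnsVector)))⟫_ℂ = 0 at h2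
    rwa [hpow, extensionRep_incl] at h2
  intro x
  refine (inner_eq_zero_symm (𝕜 := ℂ) (x := y) (y := (V ^ n) (Z x))).1 ?_
  exact congrArg (fun T : S.GNSSpace →L[ℂ] ℂ => T x) h1

/-- The covariant GNS representation on the space of the minimal unitary extension of `U`. -/
def extensionCovariantGNS : S.CovariantGNS (unitaryExtensionSpace S.U) where
  Z := unitaryExtensionIncl S.U
  Z_isometry := norm_unitaryExtensionIncl
  π := S.extensionRep
  π_Z := S.extensionRep_incl
  Ω := unitaryExtensionIncl S.U S.gnsVector
  Ω_eq := rfl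
  V := unitaryExtensionInv S.U S.star_U_mul_U
  V_isometry := norm_unitaryExtensionInv S.star_U_mul_U
  dilation n := by
    ext h
    refine ext_inner_left ℂ fun k => ?_
    change ⟪k, adjoint (unitaryExtensionIncl S.U) ((unitaryExtensionInv S.U S.star_U_mul_U ^ n)
      (unitaryExtensionIncl S.U h))⟫_ℂ = _
    rw [adjoint_inner_right, inner_unitaryExtensionIncl, unitaryExtensionInv_pow_apply_zero,
      unitaryExtensionIncl_val, lp.single_apply_self]
  V_Ω := S.unitaryExtensionInv_gnsVector
  cyclic := S.isCyclicVector_unitaryExtensionIncl_gnsVector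
  covariant a := by
    rw [mul_assoc, extensionRep_mul_unitaryExtensionInv, ← mul_assoc]
    have h : star (unitaryExtensionInv S.U S.star_U_mul_U)
        * unitaryExtensionInv S.U S.star_U_mul_U = 1 :=
      (ContinuousLinearMap.norm_map_iff_adjoint_comp_self _).1
        (norm_unitaryExtensionInv S.star_U_mul_U)
    rw [h, one_mul]
  state_eq a := by
    rw [extensionRep_incl, inner_unitaryExtensionIncl, unitaryExtensionIncl_val,
      lp.single_apply_self]
    have h := S.inner_gnsRep_gnsVector 1 a
    rwa [gnsRep_one_gnsVector, star_one, one_mul, eq_comm] at h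

end MultiplicativeSystem

/-! ### Double commutants, conjugations, compressions and vector states -/

section Constructions

variable {H : Type*} [NormedAddCommGroup H] [InnerProductSpace ℂ H] [CompleteSpace H]
variable {K : Type*} [NormedAddCommGroup K] [InnerProductSpace ℂ K] [CompleteSpace K]
variable {L : Type*} [NormedAddCommGroup L] [InnerProductSpace ℂ L] [CompleteSpace L]

theorem inner_self_nonneg_complex (x : H) : 0 ≤ ⟪x, x⟫_ℂ := by
  rw [inner_self_eq_norm_sq_to_K]
  exact pow_nonneg (RCLike.ofReal_nonneg.2 (norm_nonneg x)) 2

theorem mem_commutant_doubleCommutant {B : StarSubalgebra ℂ (H →L[ℂ] H)} {y : H →L[ℂ] H} :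
    y ∈ (doubleCommutant B).commutant ↔ ∀ b ∈ B, b * y = y * b := by
  have h : ((doubleCommutant B).commutant : Set (H →L[ℂ] H))
      = Set.centralizer (B : Set (H →L[ℂ] H)) := by
    rw [VonNeumannAlgebra.coe_commutant, doubleCommutant, VonNeumannAlgebra.coe_mk,
      StarSubalgebra.coe_centralizer_centralizer, Set.centralizer_centralizer_centralizer,
      Set.union_eq_left.2 fun x hx => by simpa using star_mem (s := B) hx]
  rw [← SetLike.mem_coe, h]
  rfl

theorem le_doubleCommutant {B : StarSubalgebra ℂ (H →L[ℂ] H)} {b : H →L[ℂ] H} (hb : b ∈ B) :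
    b ∈ doubleCommutant B :=
  VonNeumannAlgebra.mem_of_commute fun _ hy => mem_commutant_doubleCommutant.1 hy b hb

theorem doubleCommutant_le {B : StarSubalgebra ℂ (H →L[ℂ] H)} {R : VonNeumannAlgebra H}
    (h : ∀ b ∈ B, b ∈ R) : doubleCommutant B ≤ R := fun X hX => by
  refine VonNeumannAlgebra.mem_of_commute fun y hy => ?_
  exact VonNeumannAlgebra.commute_of_mem hX
    (mem_commutant_doubleCommutant.2 fun b hb => VonNeumannAlgebra.commute_of_mem (h b hb) hy)

theorem conj_commute_of_forall_mem {B : StarSubalgebra ℂ (H →L[ℂ] H)} {W W' : H →L[ℂ] H}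
    (hW : W' * W = 1) (hB : ∀ b ∈ B, W * b * W' ∈ B) {y : H →L[ℂ] H}
    (hy : ∀ b ∈ B, b * y = y * b) : ∀ b ∈ B, b * (W' * y * W) = W' * y * W * b := fun b hb => by
  calc b * (W' * y * W) = (W' * W) * b * (W' * y * W) := by rw [hW, one_mul]
    _ = W' * ((W * b * W') * y) * W := by noncomm_ring
    _ = W' * (y * (W * b * W')) * W := by rw [hy _ (hB b hb)]
    _ = W' * y * W * b * (W' * W) := by noncomm_ring
    _ = W' * y * W * b := by rw [hW, mul_one]

/-- Dual to `conj_commute_of_forall_mem`: `W · W'` preserves `B`, so `W' · W` preserves the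
commutant, and hence `W · W'` preserves the double commutant. -/
theorem conj_mem_doubleCommutant {B : StarSubalgebra ℂ (H →L[ℂ] H)} {W W' : H →L[ℂ] H}
    (hW : W' * W = 1) (hW' : W * W' = 1) (hB : ∀ b ∈ B, W * b * W' ∈ B) {X : H →L[ℂ] H}
    (hX : X ∈ doubleCommutant B) : W * X * W' ∈ doubleCommutant B := by
  refine VonNeumannAlgebra.mem_of_commute fun y hy => ?_
  have h1 := VonNeumannAlgebra.commute_of_mem hX (mem_commutant_doubleCommutant.2
    (conj_commute_of_forall_mem hW hB (mem_commutant_doubleCommutant.1 hy)))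
  calc W * X * W' * y = W * X * W' * y * (W * W') := by rw [hW', mul_one]
    _ = W * (X * (W' * y * W)) * W' := by noncomm_ring
    _ = W * (W' * y * W * X) * W' := by rw [h1]
    _ = (W * W') * y * (W * X * W') := by noncomm_ring
    _ = y * (W * X * W') := by rw [hW', one_mul]

/-- The endomorphism `X ↦ W* X W` of `B″`, for a unitary `W` with `W* B W ⊆ B`. -/
def conjStarAlgHom {B : StarSubalgebra ℂ (H →L[ℂ] H)} {W : H →L[ℂ] H} (hW : star W * W = 1)
    (hW' : W * star W = 1) (hB : ∀ b ∈ B, star W * b * W ∈ B) :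
    (doubleCommutant B).toStarSubalgebra →⋆ₐ[ℂ] (doubleCommutant B).toStarSubalgebra where
  toFun X := ⟨star W * (X : H →L[ℂ] H) * W, conj_mem_doubleCommutant hW' hW hB X.2⟩
  map_one' := Subtype.ext (by
    change star W * 1 * W = 1
    rw [mul_one, hW])
  map_mul' X Y := Subtype.ext (by
    change star W * ((X : H →L[ℂ] H) * (Y : H →L[ℂ] H)) * W
      = star W * (X : H →L[ℂ] H) * W * (star W * (Y : H →L[ℂ] H) * W)
    calc star W * ((X : H →L[ℂ] H) * (Y : H →L[ℂ] H)) * W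
        = star W * (X : H →L[ℂ] H) * 1 * (Y : H →L[ℂ] H) * W := by
          simp only [mul_assoc, one_mul]
      _ = _ := by
          rw [← hW']
          simp only [mul_assoc])
  map_zero' := Subtype.ext (by simp)
  map_add' X Y := Subtype.ext (by
    change star W * ((X : H →L[ℂ] H) + (Y : H →L[ℂ] H)) * W
      = star W * (X : H →L[ℂ] H) * W + star W * (Y : H →L[ℂ] H) * W
    rw [mul_add, add_mul])
  commutes' r := Subtype.ext (by
    change star W * (algebraMap ℂ (H →L[ℂ] H) r) * W = algebraMap ℂ (H →L[ℂ] H) r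
    rw [← Algebra.commutes, mul_assoc, hW, mul_one])
  map_star' X := Subtype.ext (by
    change star W * star (X : H →L[ℂ] H) * W = star (star W * (X : H →L[ℂ] H) * W)
    rw [star_mul, star_mul, star_star, mul_assoc])

/-- Compressions of representations are completely positive. -/
theorem isUCPMap_of_compression {M : VonNeumannAlgebra H} {N : VonNeumannAlgebra K}
    {f : M.toStarSubalgebra →ₗ[ℂ] N.toStarSubalgebra} (h1 : f 1 = 1)
    (ρ : M.toStarSubalgebra →⋆ₐ[ℂ] (L →L[ℂ] L)) (T : K →L[ℂ] L)
    (hf : ∀ X, (f X : K →L[ℂ] K) = adjoint T ∘L ρ X ∘L T) : IsUCPMap M N f := by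
  refine ⟨h1, fun n X ξ => ?_⟩
  have h2 : ∑ i, ∑ j, ⟪ξ i, (f (star (X i) * X j) : K →L[ℂ] K) (ξ j)⟫_ℂ
      = ⟪∑ i, ρ (X i) (T (ξ i)), ∑ j, ρ (X j) (T (ξ j))⟫_ℂ := by
    rw [sum_inner]
    refine Finset.sum_congr rfl fun i _ => ?_
    rw [inner_sum]
    refine Finset.sum_congr rfl fun j _ => ?_
    rw [hf, map_mul, map_star, ← inner_star_mul_apply]
    exact adjoint_inner_right T (ξ i) ((star (ρ (X i)) * ρ (X j)) (T (ξ j)))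
  rw [h2]
  exact inner_self_nonneg_complex _

theorem isUCPMap_starAlgHom {M : VonNeumannAlgebra H} {N : VonNeumannAlgebra K}
    (i : M.toStarSubalgebra →⋆ₐ[ℂ] N.toStarSubalgebra) :
    IsUCPMap M N i.toAlgHom.toLinearMap :=
  isUCPMap_of_compression (map_one i) (N.toStarSubalgebra.subtype.comp i) 1 fun X => by
    have h : adjoint (1 : K →L[ℂ] K) = 1 := star_one _
    rw [h]
    rfl

theorem isNormalMap_of_compression {M : VonNeumannAlgebra H} {N : VonNeumannAlgebra K}
    {f : M.toStarSubalgebra → N.toStarSubalgebra} (T : K →L[ℂ] H)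
    (hf : ∀ X, (f X : K →L[ℂ] K) = adjoint T ∘L (X : H →L[ℂ] H) ∘L T) : IsNormalMap M N f := by
  refine isNormalMap_of_forall fun ξ η hξ hη => ?_
  have hs : ∀ ζ : ℕ → K, (Summable fun n => ‖ζ n‖ ^ 2) → Summable fun n => ‖T (ζ n)‖ ^ 2 :=
    fun ζ hζ => Summable.of_nonneg_of_le (fun n => sq_nonneg _) (fun n => by
      rw [← mul_pow]
      exact pow_le_pow_left₀ (norm_nonneg _) (T.le_opNorm _) 2) (hζ.mul_left (‖T‖ ^ 2))
  convert isNormalFunctional_tsum M (hs ξ hξ) (hs η hη) using 2 with X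
  refine tsum_congr fun n => ?_
  rw [hf]
  exact adjoint_inner_right T (ξ n) ((X : H →L[ℂ] H) (T (η n)))

/-- The W*-dynamical system given by a cyclic unit vector of the commutant. -/
def WStarDynamicalSystem.ofVector {M : VonNeumannAlgebra H} {Ω : H}
    (hΩ : IsCyclicVector (M.commutant : Set (H →L[ℂ] H)) Ω) (hnorm : ‖Ω‖ = 1)
    (Θ : M.toStarSubalgebra →⋆ₐ[ℂ] M.toStarSubalgebra) (hΘ : IsNormalMap M M Θ)
    (hinv : ∀ X, ⟪Ω, (Θ X : H →L[ℂ] H) Ω⟫_ℂ = ⟪Ω, (X : H →L[ℂ] H) Ω⟫_ℂ) :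
    WStarDynamicalSystem M where
  dynamics := Θ.toAlgHom.toLinearMap
  state :=
    { toFun := fun X => ⟪Ω, (X : H →L[ℂ] H) Ω⟫_ℂ
      map_add' := fun X Y => inner_add_right _ _ _
      map_smul' := fun c X => inner_smul_right _ _ _ }
  dynamics_ucp := isUCPMap_starAlgHom Θ
  dynamics_normal := hΘ
  state_nonneg X := by
    change 0 ≤ ⟪Ω, (star (X : H →L[ℂ] H) * (X : H →L[ℂ] H)) Ω⟫_ℂ
    rw [inner_star_mul_apply]
    exact inner_self_nonneg_complex _
  state_one := by
    change ⟪Ω, Ω⟫_ℂ = 1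
    rw [inner_self_eq_norm_sq_to_K, hnorm]
    simp
  state_normal := (isNuclear_inner Ω Ω).isNormalFunctional
  state_faithful X hX := by
    change ⟪Ω, (star (X : H →L[ℂ] H) * (X : H →L[ℂ] H)) Ω⟫_ℂ = 0 at hX
    rw [inner_star_mul_apply, inner_self_eq_zero] at hX
    exact Subtype.ext (hΩ.eq_of_mem X.2 (zero_mem M) hX)
  invariant := hinv

end Constructions

/-! ### The von Neumann algebra `π_φ(𝔄)″` and the normal extension of the dynamics -/

namespace MultiplicativeSystem

variable {A : Type u} [CStarAlgebra A] [PartialOrder A] [StarOrderedRing A]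
variable {S : MultiplicativeSystem A} {Ψ : A →CP A}
variable {K : Type v} [NormedAddCommGroup K] [InnerProductSpace ℂ K] [CompleteSpace K]

theorem mem_commutant_gnsAlgebra {y : S.GNSSpace →L[ℂ] S.GNSSpace} :
    y ∈ S.gnsAlgebra.commutant ↔ ∀ a, S.gnsRep a * y = y * S.gnsRep a := by
  refine mem_commutant_doubleCommutant.trans ⟨fun h a => h _ ⟨a, rfl⟩, ?_⟩
  rintro h _ ⟨a, rfl⟩
  exact h a

theorem gnsRep_mem_gnsAlgebra (a : A) : S.gnsRep a ∈ S.gnsAlgebra :=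
  le_doubleCommutant ⟨a, rfl⟩

theorem isCyclicVector_commutant_gnsAlgebra
    (hcyclic : IsCyclicVector (Set.centralizer (Set.range S.gnsRep)) S.gnsVector) :
    IsCyclicVector (S.gnsAlgebra.commutant : Set (S.GNSSpace →L[ℂ] S.GNSSpace)) S.gnsVector := by
  have h : (S.gnsAlgebra.commutant : Set (S.GNSSpace →L[ℂ] S.GNSSpace))
      = Set.centralizer (Set.range S.gnsRep) := by
    ext y
    rw [SetLike.mem_coe, mem_commutant_gnsAlgebra, Set.mem_centralizer_iff, Set.forall_mem_range]
  rwa [h]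

theorem norm_gnsVector : ‖S.gnsVector‖ = 1 := by
  have h := S.inner_gnsRep_gnsVector 1 1
  rw [gnsRep_one_gnsVector, star_one, one_mul, S.state_one] at h
  have h1 : ‖S.gnsVector‖ ^ 2 = 1 := by
    rw [norm_sq_eq_re_inner (𝕜 := ℂ), h]
    simp
  rwa [pow_eq_one_iff_of_nonneg (norm_nonneg _) two_ne_zero] at h1

/-- If `Z` intertwines `π_φ` with a representation in `B` and compresses `B` into `π_φ(𝔄)`, then
it intertwines the commutant of `π_φ(𝔄)` with the commutant of `B`. -/
theorem exists_intertwining_commutant {B : StarSubalgebra ℂ (K →L[ℂ] K)} {Z : S.GNSSpace →L[ℂ] K}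
    (hB : IsCyclicVector (B : Set (K →L[ℂ] K)) (Z S.gnsVector)) {ρ : A → K →L[ℂ] K}
    (hρB : ∀ a, ρ a ∈ B) (hρ : ∀ a h, ρ a (Z h) = Z (S.gnsRep a h))
    (hZ : ∀ b ∈ B, ∃ a, adjoint Z ∘L b ∘L Z = S.gnsRep a)
    {y : S.GNSSpace →L[ℂ] S.GNSSpace} (hy : ∀ a, S.gnsRep a * y = y * S.gnsRep a) :
    ∃ J : K →L[ℂ] K, (∀ b ∈ B, b * J = J * b) ∧ (∀ h, J (Z h) = Z (y h)) ∧
      ∀ h, adjoint J (Z h) = Z (adjoint y h) := by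
  obtain ⟨J, hJB, hJ, hJ'⟩ := exists_commutant_lift (Ω := S.gnsVector) (y := y) hB fun b hb => by
    obtain ⟨a, ha⟩ := hZ b hb
    rw [ha]
    exact (hy a).symm
  -- Since `T` commutes with `ρ(a)` and `z` with `π_φ(a)`, the relation `T Z = Z z` spreads from
  -- `Ω_φ` to all `π_φ(a) Ω_φ`. It serves for `J` with `y` and for the adjoints.
  have key : ∀ (T : K →L[ℂ] K) (z : S.GNSSpace →L[ℂ] S.GNSSpace), (∀ b ∈ B, b * T = T * b) →
      (∀ a, S.gnsRep a * z = z * S.gnsRep a) → T (Z S.gnsVector) = Z (z S.gnsVector) →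
      ∀ h, T (Z h) = Z (z h) := fun T z hT hz h => by
    have h1 : T ∘L Z = Z ∘L z := S.ext_gnsVector fun a => by
      change T (Z (S.gnsRep a S.gnsVector)) = Z (z (S.gnsRep a S.gnsVector))
      have h2 : ρ a (T (Z S.gnsVector)) = T (ρ a (Z S.gnsVector)) :=
        congrArg (fun R : K →L[ℂ] K => R (Z S.gnsVector)) (hT _ (hρB a))
      have h3 : S.gnsRep a (z S.gnsVector) = z (S.gnsRep a S.gnsVector) :=
        congrArg (fun R : S.GNSSpace →L[ℂ] S.GNSSpace => R S.gnsVector) (hz a)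
      rw [← hρ, ← h2, h, hρ, h3]
    exact fun x => congrArg (fun R : S.GNSSpace →L[ℂ] K => R x) h1
  refine ⟨J, hJB, key J y hJB hy hJ, key (star J) (star y) (fun b hb => ?_) (fun a => ?_) hJ'⟩
  · have h1 := congrArg star (hJB _ (star_mem hb))
    simpa using h1.symm
  · have h1 := congrArg star (hy (star a))
    simpa [← map_star] using h1.symm

/-- The normal extension `Φ_•` of `Φ` to `π_φ(𝔄)″`. -/
theorem exists_extended_dynamics
    (hcyclic : IsCyclicVector (Set.centralizer (Set.range S.gnsRep)) S.gnsVector)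
    (hΨ : S.IsStateAdjoint Ψ) :
    ∃ Θ : S.gnsAlgebra.toStarSubalgebra →⋆ₐ[ℂ] S.gnsAlgebra.toStarSubalgebra,
      IsNormalMap S.gnsAlgebra S.gnsAlgebra Θ ∧
      ∀ X h, (Θ X : S.GNSSpace →L[ℂ] S.GNSSpace) (S.U h)
        = S.U ((X : S.GNSSpace →L[ℂ] S.GNSSpace) h) := by
  have hM := isCyclicVector_commutant_gnsAlgebra hcyclic
  refine exists_normal_starAlgHom (Z := S.U) hM (by rwa [U_gnsVector]) (fun y hy => ?_)
    (fun y hy => ?_)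
  · rw [mem_commutant_gnsAlgebra] at hy ⊢
    intro a
    ext h
    change S.gnsRep a (adjoint S.U (y (S.U h))) = adjoint S.U (y (S.U (S.gnsRep a h)))
    have h1 : S.gnsRep (S.dynamics a) (y (S.U h)) = y (S.gnsRep (S.dynamics a) (S.U h)) :=
      congrArg (fun R : S.GNSSpace →L[ℂ] S.GNSSpace => R (S.U h)) (hy (S.dynamics a))
    rw [U_gnsRep, ← adjoint_U_gnsRep, h1]
  · obtain ⟨J, hJB, hJ, -⟩ := exists_intertwining_commutant (B := S.gnsRep.range) (Z := S.U)
      (by rw [U_gnsVector]; exact S.isCyclicVector_gnsVector)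
      (ρ := fun a => S.gnsRep (S.dynamics a)) (fun a => ⟨S.dynamics a, rfl⟩)
      (fun a h => (S.U_gnsRep a h).symm)
      (by
        rintro _ ⟨a, rfl⟩
        exact ⟨Ψ a, ContinuousLinearMap.ext fun h => hΨ.adjoint_U_gnsRep_U hcyclic a h⟩)
      (mem_commutant_gnsAlgebra.1 hy)
    exact ⟨J, mem_commutant_doubleCommutant.2 hJB, hJ⟩

end MultiplicativeSystem

/-! ### Structure of an arbitrary covariant GNS representation -/

namespace MultiplicativeSystem.CovariantGNS

variable {A : Type u} [CStarAlgebra A] [PartialOrder A] [StarOrderedRing A]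
variable {S : MultiplicativeSystem A} {Ψ : A →CP A}
variable {K : Type v} [NormedAddCommGroup K] [InnerProductSpace ℂ K] [CompleteSpace K]
variable (C : S.CovariantGNS K)

theorem star_V_mul_V : star C.V * C.V = 1 :=
  (ContinuousLinearMap.norm_map_iff_adjoint_comp_self C.V).1 C.V_isometry

theorem adjoint_Z_Z (h : S.GNSSpace) : adjoint C.Z (C.Z h) = h := by
  have h1 := (ContinuousLinearMap.norm_map_iff_adjoint_comp_self C.Z).1 C.Z_isometry
  exact congrArg (fun T : S.GNSSpace →L[ℂ] S.GNSSpace => T h) h1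

/-- Put `T = (1 - VV*) π(a) V`. Then `T* T = π(Φ(a* a)) - π(Φ(a*)) π(Φ(a)) = 0` because `Φ` is
multiplicative, so `π(a) V = V V* π(a) V`. -/
theorem π_mul_V (a : A) : C.π a * C.V = C.V * C.π (S.dynamics a) := by
  have hVV := C.star_V_mul_V
  have h1 : star ((1 - C.V * star C.V) * C.π a * C.V) * ((1 - C.V * star C.V) * C.π a * C.V)
      = 0 := by
    have h2 : star (1 - C.V * star C.V) = 1 - C.V * star C.V := by simp
    have h3 : (1 - C.V * star C.V) * (1 - C.V * star C.V) = 1 - C.V * star C.V := by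
      have : (1 - C.V * star C.V) * (1 - C.V * star C.V)
        = 1 - C.V * star C.V - C.V * star C.V + C.V * (star C.V * C.V) * star C.V := by
        noncomm_ring
      rw [this, hVV]
      noncomm_ring
    calc star ((1 - C.V * star C.V) * C.π a * C.V) * ((1 - C.V * star C.V) * C.π a * C.V)
        = star C.V * star (C.π a) * ((1 - C.V * star C.V) * (1 - C.V * star C.V)) * C.π a * C.V := by
          rw [star_mul, star_mul, h2]
          noncomm_ring
      _ = star C.V * (star (C.π a) * C.π a) * C.V
          - (star C.V * star (C.π a) * C.V) * (star C.V * C.π a * C.V) := by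
          rw [h3]
          noncomm_ring
      _ = 0 := by
          rw [← map_star, ← map_mul, ← C.covariant, ← C.covariant, ← C.covariant, map_mul,
            map_mul, sub_self]
  have h4 := CStarRing.star_mul_self_eq_zero_iff _ |>.1 h1
  have h5 : (1 - C.V * star C.V) * C.π a * C.V
      = C.π a * C.V - C.V * (star C.V * C.π a * C.V) := by noncomm_ring
  rw [h5, ← C.covariant, sub_eq_zero] at h4
  exact h4

theorem star_V_mul_π (a : A) : star C.V * C.π a = C.π (S.dynamics a) * star C.V := by
  have h := congrArg star (C.π_mul_V (star a))
  simpa [← map_star] using h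

theorem star_V_Ω : star C.V C.Ω = C.Ω := by
  conv_lhs => rw [← C.V_Ω]
  exact congrArg (fun T : K →L[ℂ] K => T C.Ω) C.star_V_mul_V

theorem star_V_pow_Ω (n : ℕ) : (star C.V ^ n) C.Ω = C.Ω := by
  induction n with
  | zero => rfl
  | succ n ih =>
    rw [pow_succ]
    change (star C.V ^ n) (star C.V C.Ω) = C.Ω
    rw [C.star_V_Ω, ih]

/-- The range projection `VV*` commutes with all generators of `𝔅` and fixes the cyclic vector
`Ω_∞`. -/
theorem V_mul_star_V : C.V * star C.V = 1 := by
  have hVV := C.star_V_mul_V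
  have hle : translatesAlgebra C.π C.V ≤ StarSubalgebra.centralizer ℂ {C.V * star C.V} := by
    refine StarAlgebra.adjoin_le ?_
    rintro _ ⟨n, a, rfl⟩
    rw [SetLike.mem_coe, StarSubalgebra.mem_centralizer_iff]
    have h : C.V * star C.V * (C.V ^ n * C.π a * star C.V ^ n)
        = C.V ^ n * C.π a * star C.V ^ n * (C.V * star C.V) := by
      cases n with
      | zero =>
        simp only [pow_zero, one_mul, mul_one]
        rw [mul_assoc, C.star_V_mul_π, ← mul_assoc, ← mul_assoc, C.π_mul_V]
      | succ n =>
        have h1 : C.V * star C.V * C.V ^ (n + 1) = C.V ^ (n + 1) := by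
          rw [pow_succ', mul_assoc, ← mul_assoc (star C.V), hVV, one_mul]
        have h2 : star C.V ^ (n + 1) * (C.V * star C.V) = star C.V ^ (n + 1) := by
          rw [pow_succ, mul_assoc, ← mul_assoc (star C.V) C.V, hVV, one_mul]
        rw [← mul_assoc, ← mul_assoc, h1, mul_assoc _ (star C.V ^ (n + 1)), h2]
    rintro _ rfl
    refine ⟨h, ?_⟩
    simpa using h
  refine C.cyclic.eq_of_apply_eq (fun y hy => ?_) (fun y _ => by rw [one_mul, mul_one]) ?_
  · exact ((StarSubalgebra.mem_centralizer_iff ℂ).1 (hle hy) _ rfl).1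
  · change C.V (star C.V C.Ω) = C.Ω
    rw [C.star_V_Ω, C.V_Ω]

theorem star_V_pow_mul_V_pow (n : ℕ) : star C.V ^ n * C.V ^ n = 1 := by
  induction n with
  | zero => simp
  | succ n ih =>
    rw [pow_succ (star C.V), pow_succ' C.V, mul_assoc, ← mul_assoc (star C.V) C.V, C.star_V_mul_V,
      one_mul, ih]

/-- It makes the algebras `Vᵏ π_∞(𝔄) V*ᵏ` increase with `k`, so that two elements of `𝔅` can be
written with the same exponent. -/
theorem translate_succ (k : ℕ) (a : A) :
    C.V ^ (k + 1) * C.π (S.dynamics a) * star C.V ^ (k + 1) = C.V ^ k * C.π a * star C.V ^ k :=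
  calc C.V ^ (k + 1) * C.π (S.dynamics a) * star C.V ^ (k + 1)
      = C.V ^ k * (C.V * C.π (S.dynamics a)) * (star C.V * star C.V ^ k) := by
        rw [pow_succ, pow_succ']
        noncomm_ring
    _ = C.V ^ k * C.π a * (C.V * star C.V) * star C.V ^ k := by
        rw [← C.π_mul_V]
        noncomm_ring
    _ = C.V ^ k * C.π a * star C.V ^ k := by rw [C.V_mul_star_V, mul_one]

theorem exists_translate_add (k n : ℕ) (a : A) : ∃ b,
    C.V ^ k * C.π a * star C.V ^ k = C.V ^ (k + n) * C.π b * star C.V ^ (k + n) := by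
  induction n with
  | zero => exact ⟨a, rfl⟩
  | succ n ih =>
    obtain ⟨b, hb⟩ := ih
    exact ⟨S.dynamics b, by rw [hb, ← C.translate_succ, add_assoc]⟩

/-- The algebra `𝔅` is the increasing union of the algebras `Vᵏ π_∞(𝔄) V*ᵏ`. -/
theorem exists_eq_translate {b : K →L[ℂ] K} (hb : b ∈ translatesAlgebra C.π C.V) :
    ∃ (k : ℕ) (a : A), b = C.V ^ k * C.π a * star C.V ^ k := by
  have hpair : ∀ {x y : K →L[ℂ] K}, (∃ (k : ℕ) (a : A), x = C.V ^ k * C.π a * star C.V ^ k) →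
      (∃ (k : ℕ) (a : A), y = C.V ^ k * C.π a * star C.V ^ k) →
      ∃ (k : ℕ) (a a' : A), x = C.V ^ k * C.π a * star C.V ^ k ∧
        y = C.V ^ k * C.π a' * star C.V ^ k := by
    rintro x y ⟨k, a, rfl⟩ ⟨k', a', rfl⟩
    obtain ⟨c, hc⟩ := C.exists_translate_add k k' a
    obtain ⟨c', hc'⟩ := C.exists_translate_add k' k a'
    exact ⟨k + k', c, c', hc, by rw [hc', add_comm]⟩
  induction hb using StarAlgebra.adjoin_induction with
  | mem x hx => exact hx
  | algebraMap r =>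
    refine ⟨0, algebraMap ℂ A r, ?_⟩
    rw [pow_zero, pow_zero, one_mul, mul_one, AlgHomClass.commutes]
  | add x y _ _ hx hy =>
    obtain ⟨k, a, a', rfl, rfl⟩ := hpair hx hy
    exact ⟨k, a + a', by rw [map_add]; noncomm_ring⟩
  | mul x y _ _ hx hy =>
    obtain ⟨k, a, a', rfl, rfl⟩ := hpair hx hy
    refine ⟨k, a * a', ?_⟩
    calc C.V ^ k * C.π a * star C.V ^ k * (C.V ^ k * C.π a' * star C.V ^ k)
        = C.V ^ k * C.π a * (star C.V ^ k * C.V ^ k) * C.π a' * star C.V ^ k := by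
          simp only [mul_assoc]
      _ = _ := by
          rw [C.star_V_pow_mul_V_pow, mul_one, map_mul]
          simp only [mul_assoc]
  | star x _ hx =>
    obtain ⟨k, a, rfl⟩ := hx
    refine ⟨k, star a, ?_⟩
    rw [star_mul, star_mul, star_pow, star_pow, star_star, map_star, mul_assoc]

theorem translate_mem (k : ℕ) (a : A) :
    C.V ^ k * C.π a * star C.V ^ k ∈ translatesAlgebra C.π C.V :=
  StarAlgebra.subset_adjoin ℂ _ ⟨k, a, rfl⟩

theorem π_mem (a : A) : C.π a ∈ translatesAlgebra C.π C.V := by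
  simpa using C.translate_mem 0 a

theorem V_conj_mem {b : K →L[ℂ] K} (hb : b ∈ translatesAlgebra C.π C.V) :
    C.V * b * star C.V ∈ translatesAlgebra C.π C.V := by
  obtain ⟨k, a, rfl⟩ := C.exists_eq_translate hb
  have h : C.V * (C.V ^ k * C.π a * star C.V ^ k) * star C.V
      = C.V ^ (k + 1) * C.π a * star C.V ^ (k + 1) := by
    rw [pow_succ' C.V, pow_succ (star C.V)]
    simp only [mul_assoc]
  rw [h]
  exact C.translate_mem _ _

theorem star_V_conj_mem {b : K →L[ℂ] K} (hb : b ∈ translatesAlgebra C.π C.V) :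
    star C.V * b * C.V ∈ translatesAlgebra C.π C.V := by
  obtain ⟨k, a, rfl⟩ := C.exists_eq_translate hb
  have h : star C.V * (C.V ^ k * C.π a * star C.V ^ k) * C.V
      = C.V ^ k * C.π (S.dynamics a) * star C.V ^ k :=
    calc star C.V * (C.V ^ k * C.π a * star C.V ^ k) * C.V
        = star C.V * (C.V ^ (k + 1) * C.π (S.dynamics a) * star C.V ^ (k + 1)) * C.V := by
          rw [C.translate_succ]
      _ = (star C.V * C.V) * (C.V ^ k * C.π (S.dynamics a) * star C.V ^ k)
          * (star C.V * C.V) := by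
          rw [pow_succ' C.V, pow_succ (star C.V)]
          simp only [mul_assoc]
      _ = _ := by rw [C.star_V_mul_V, one_mul, mul_one]
  rw [h]
  exact C.translate_mem _ _

/-- The dilation property for `n = 1` only gives `Z* V* Z = U`. But `V*` is now isometric, so `V* Z
h` and `Z U h` both have norm `‖h‖`, and their inner product has real part `‖h‖²`; hence they
coincide. -/
theorem star_V_Z (h : S.GNSSpace) : star C.V (C.Z h) = C.Z (S.U h) := by
  have h1 : ∀ k l, ⟪C.Z k, star C.V (C.Z l)⟫_ℂ = ⟪k, S.U l⟫_ℂ := fun k l => by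
    have h2 := congrArg (fun T : S.GNSSpace →L[ℂ] S.GNSSpace => ⟪T k, l⟫_ℂ) (C.dilation 1)
    rw [pow_one, pow_one] at h2
    change ⟪adjoint C.Z (C.V (C.Z k)), l⟫_ℂ = ⟪adjoint S.U k, l⟫_ℂ at h2
    rw [adjoint_inner_left, adjoint_inner_left] at h2
    rw [star_eq_adjoint, adjoint_inner_right, h2]
  have hnorm : ‖star C.V (C.Z h)‖ = ‖h‖ := by
    have h3 := (ContinuousLinearMap.norm_map_iff_adjoint_comp_self (star C.V)).2
      (by rw [← star_eq_adjoint, star_star]; exact C.V_mul_star_V)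
    rw [h3, C.Z_isometry]
  have h4 : RCLike.re ⟪star C.V (C.Z h), C.Z (S.U h)⟫_ℂ = ‖h‖ ^ 2 := by
    rw [inner_re_symm, h1, ← norm_sq_eq_re_inner, S.norm_U_apply]
  rw [← sub_eq_zero, ← norm_eq_zero, ← pow_eq_zero_iff two_ne_zero, @norm_sub_sq ℂ, h4, hnorm,
    C.Z_isometry, S.norm_U_apply]
  ring

theorem star_V_pow_Z (n : ℕ) (h : S.GNSSpace) :
    (star C.V ^ n) (C.Z h) = C.Z ((S.U ^ n) h) := by
  induction n generalizing h with
  | zero => rfl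
  | succ n ih =>
    rw [pow_succ, pow_succ]
    change (star C.V ^ n) (star C.V (C.Z h)) = C.Z ((S.U ^ n) (S.U h))
    rw [C.star_V_Z, ih]

theorem adjoint_Z_π (a : A) (x : K) : adjoint C.Z (C.π a x) = S.gnsRep a (adjoint C.Z x) := by
  refine ext_inner_right ℂ fun k => ?_
  have h1 : ∀ x y, ⟪C.π a x, y⟫_ℂ = ⟪x, C.π (star a) y⟫_ℂ := fun x y => by
    rw [map_star, star_eq_adjoint, adjoint_inner_right]
  have h2 : ∀ x y, ⟪S.gnsRep a x, y⟫_ℂ = ⟪x, S.gnsRep (star a) y⟫_ℂ := fun x y => by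
    rw [map_star, star_eq_adjoint, adjoint_inner_right]
  rw [adjoint_inner_left, h1, C.π_Z, h2, adjoint_inner_left]

theorem _root_.MultiplicativeSystem.IsStateAdjoint.adjoint_U_pow (hΨ : S.IsStateAdjoint Ψ)
    (hcyclic : IsCyclicVector (Set.centralizer (Set.range S.gnsRep)) S.gnsVector) (k : ℕ) (a : A) :
    star S.U ^ k * S.gnsRep a * S.U ^ k = S.gnsRep (Ψ^[k] a) := by
  induction k generalizing a with
  | zero => simp
  | succ k ih =>
    have h : star S.U * S.gnsRep a * S.U = S.gnsRep (Ψ a) :=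
      ContinuousLinearMap.ext fun h => hΨ.adjoint_U_gnsRep_U hcyclic a h
    rw [Function.iterate_succ_apply, ← ih, ← h, pow_succ, pow_succ']
    simp only [mul_assoc]

theorem compression_translate (hΨ : S.IsStateAdjoint Ψ)
    (hcyclic : IsCyclicVector (Set.centralizer (Set.range S.gnsRep)) S.gnsVector) (k : ℕ) (a : A) :
    adjoint C.Z ∘L (C.V ^ k * C.π a * star C.V ^ k) ∘L C.Z = S.gnsRep (Ψ^[k] a) := by
  rw [← hΨ.adjoint_U_pow hcyclic]
  ext h
  refine ext_inner_left ℂ fun l => ?_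
  change ⟪l, adjoint C.Z ((C.V ^ k) (C.π a ((star C.V ^ k) (C.Z h))))⟫_ℂ
    = ⟪l, (star S.U ^ k) (S.gnsRep a ((S.U ^ k) h))⟫_ℂ
  rw [adjoint_inner_right, ← adjoint_inner_left (C.V ^ k), ← star_eq_adjoint, star_pow,
    C.star_V_pow_Z, C.star_V_pow_Z, C.π_Z, ← adjoint_inner_right C.Z, C.adjoint_Z_Z, ← star_pow,
    star_eq_adjoint, adjoint_inner_right]

end MultiplicativeSystem.CovariantGNS

/-! ### The dilation on `𝔅″` and its minimality -/

namespace MultiplicativeSystem.CovariantGNS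

variable {A : Type u} [CStarAlgebra A] [PartialOrder A] [StarOrderedRing A]
variable {S : MultiplicativeSystem A} {Ψ : A →CP A}
variable {K : Type v} [NormedAddCommGroup K] [InnerProductSpace ℂ K] [CompleteSpace K]
variable (C : S.CovariantGNS K)

theorem exists_lift_commutant (hΨ : S.IsStateAdjoint Ψ)
    (hcyclic : IsCyclicVector (Set.centralizer (Set.range S.gnsRep)) S.gnsVector)
    {y : S.GNSSpace →L[ℂ] S.GNSSpace} (hy : y ∈ S.gnsAlgebra.commutant) :
    ∃ J ∈ C.algebra.commutant, (∀ h, J (C.Z h) = C.Z (y h)) ∧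
      ∀ h, adjoint J (C.Z h) = C.Z (adjoint y h) := by
  obtain ⟨J, hJB, hJ⟩ := exists_intertwining_commutant (B := translatesAlgebra C.π C.V)
    (by rw [← C.Ω_eq]; exact C.cyclic) C.π_mem C.π_Z
    (fun b hb => by
      obtain ⟨k, a, rfl⟩ := C.exists_eq_translate hb
      exact ⟨_, C.compression_translate hΨ hcyclic k a⟩)
    (mem_commutant_gnsAlgebra.1 hy)
  exact ⟨J, mem_commutant_doubleCommutant.2 hJB, hJ⟩

theorem V_pow_conj_mem_commutant (n : ℕ) {y : K →L[ℂ] K} (hy : y ∈ C.algebra.commutant) :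
    C.V ^ n * y * star C.V ^ n ∈ C.algebra.commutant := by
  induction n with
  | zero => simpa using hy
  | succ n ih =>
    have h := conj_commute_of_forall_mem (W := star C.V) (W' := C.V) C.V_mul_star_V
      (fun b hb => C.star_V_conj_mem hb) (mem_commutant_doubleCommutant.1 ih)
    have h1 : C.V ^ (n + 1) * y * star C.V ^ (n + 1)
        = C.V * (C.V ^ n * y * star C.V ^ n) * star C.V := by
      rw [pow_succ' C.V, pow_succ (star C.V)]
      simp only [mul_assoc]
    rw [h1]
    exact mem_commutant_doubleCommutant.2 h

/-- For a lift `J` of `y ∈ π_φ(𝔄)′`, the operator `Vⁿ J V*ⁿ` lies in `𝔅′` and sends `Ω_∞` to `Vⁿ Z y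
Ω_φ`. These vectors are total in `Vⁿ Z H_φ`, and the spaces `Vⁿ Z H_φ` together contain `𝔅 Ω_∞`. -/
theorem isCyclicVector_commutant (hΨ : S.IsStateAdjoint Ψ)
    (hcyclic : IsCyclicVector (Set.centralizer (Set.range S.gnsRep)) S.gnsVector) :
    IsCyclicVector (C.algebra.commutant : Set (K →L[ℂ] K)) C.Ω := by
  rw [IsCyclicVector, Submodule.dense_iff_topologicalClosure_eq_top,
    Submodule.topologicalClosure_eq_top_iff, Submodule.eq_bot_iff]
  intro w hw
  have h1 : ∀ n : ℕ, innerSL ℂ w ∘L (C.V ^ n) ∘L C.Z = 0 := fun n =>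
    (isCyclicVector_commutant_gnsAlgebra hcyclic).ext fun y hy => by
      obtain ⟨J, hJ, hJZ, -⟩ := C.exists_lift_commutant hΨ hcyclic hy
      have h2 := (Submodule.mem_orthogonal' _ _).1 hw _ (Submodule.subset_span
        ⟨_, C.V_pow_conj_mem_commutant n hJ, rfl⟩)
      change ⟪w, (C.V ^ n) (J ((star C.V ^ n) C.Ω))⟫_ℂ = 0 at h2
      rw [C.star_V_pow_Ω, C.Ω_eq, hJZ] at h2
      exact h2
  have h2 : innerSL ℂ w = 0 := C.cyclic.ext fun b hb => by
    obtain ⟨k, a, rfl⟩ := C.exists_eq_translate hb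
    change ⟪w, (C.V ^ k) (C.π a ((star C.V ^ k) C.Ω))⟫_ℂ = 0
    rw [C.star_V_pow_Ω, C.Ω_eq, C.π_Z]
    exact congrArg (fun T : S.GNSSpace →L[ℂ] ℂ => T (S.gnsRep a S.gnsVector)) (h1 k)
  exact inner_self_eq_zero.1 (congrArg (fun T : K →L[ℂ] ℂ => T w) h2)

/-- The normal embedding `i : π_φ(𝔄)″ → 𝔅″`. -/
theorem exists_embedding (hΨ : S.IsStateAdjoint Ψ)
    (hcyclic : IsCyclicVector (Set.centralizer (Set.range S.gnsRep)) S.gnsVector) :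
    ∃ i : S.gnsAlgebra.toStarSubalgebra →⋆ₐ[ℂ] C.algebra.toStarSubalgebra,
      IsNormalMap S.gnsAlgebra C.algebra i ∧
      ∀ X h, (i X : K →L[ℂ] K) (C.Z h) = C.Z ((X : S.GNSSpace →L[ℂ] S.GNSSpace) h) := by
  refine exists_normal_starAlgHom (isCyclicVector_commutant_gnsAlgebra hcyclic)
    (by rw [← C.Ω_eq]; exact C.isCyclicVector_commutant hΨ hcyclic) (fun y hy => ?_)
    (fun y hy => ?_)
  · refine mem_commutant_gnsAlgebra.2 fun a => ?_
    ext h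
    change S.gnsRep a (adjoint C.Z (y (C.Z h))) = adjoint C.Z (y (C.Z (S.gnsRep a h)))
    have h1 : C.π a (y (C.Z h)) = y (C.π a (C.Z h)) := congrArg (fun R : K →L[ℂ] K => R (C.Z h))
      (mem_commutant_doubleCommutant.1 hy _ (C.π_mem a))
    rw [← C.π_Z, ← h1, C.adjoint_Z_π]
  · obtain ⟨J, hJ, hJZ, -⟩ := C.exists_lift_commutant hΨ hcyclic hy
    exact ⟨J, hJ, hJZ⟩

/-- For `y ∈ π_φ(𝔄)′` with lift `J ∈ 𝔅′`: `Z* X Z y = Z* X J Z = Z* J X Z = y Z* X Z`. The last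
equality is the relation `J* Z = Z y*`, for which the adjoint of the lift was tracked. -/
theorem compression_mem (hΨ : S.IsStateAdjoint Ψ)
    (hcyclic : IsCyclicVector (Set.centralizer (Set.range S.gnsRep)) S.gnsVector)
    {X : K →L[ℂ] K} (hX : X ∈ C.algebra) : adjoint C.Z ∘L X ∘L C.Z ∈ S.gnsAlgebra := by
  refine VonNeumannAlgebra.mem_of_commute fun y hy => ?_
  obtain ⟨J, hJ, hJZ, hJZ'⟩ := C.exists_lift_commutant hΨ hcyclic hy
  ext h
  refine ext_inner_left ℂ fun l => ?_
  change ⟪l, adjoint C.Z (X (C.Z (y h)))⟫_ℂ = ⟪l, y (adjoint C.Z (X (C.Z h)))⟫_ℂ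
  have h1 : X (J (C.Z h)) = J (X (C.Z h)) :=
    congrArg (fun R : K →L[ℂ] K => R (C.Z h)) (VonNeumannAlgebra.commute_of_mem hX hJ)
  rw [adjoint_inner_right, ← hJZ, h1, ← adjoint_inner_left J, hJZ', ← adjoint_inner_left y,
    adjoint_inner_right]

/-- The conditional expectation `X ↦ Z* X Z`. -/
def expectation (hΨ : S.IsStateAdjoint Ψ)
    (hcyclic : IsCyclicVector (Set.centralizer (Set.range S.gnsRep)) S.gnsVector) :
    C.algebra.toStarSubalgebra →ₗ[ℂ] S.gnsAlgebra.toStarSubalgebra where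
  toFun X := ⟨adjoint C.Z ∘L (X : K →L[ℂ] K) ∘L C.Z, C.compression_mem hΨ hcyclic X.2⟩
  map_add' _ _ := Subtype.ext (ContinuousLinearMap.ext fun _ => map_add (adjoint C.Z) _ _)
  map_smul' _ _ := Subtype.ext (ContinuousLinearMap.ext fun _ => map_smul (adjoint C.Z) _ _)

/-- The automorphism `X ↦ V* X V` of `𝔅″`. -/
def automorphism : C.algebra.toStarSubalgebra ≃⋆ₐ[ℂ] C.algebra.toStarSubalgebra :=
  StarAlgEquiv.ofStarAlgHom
    (conjStarAlgHom C.star_V_mul_V C.V_mul_star_V fun _ hb => C.star_V_conj_mem hb)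
    (conjStarAlgHom (W := star C.V) (by rw [star_star, C.V_mul_star_V])
      (by rw [star_star, C.star_V_mul_V]) fun b hb => by
        rw [star_star]
        exact C.V_conj_mem hb)
    (StarAlgHom.ext fun X => Subtype.ext (by
      change star (star C.V) * (star C.V * (X : K →L[ℂ] K) * C.V) * star C.V = X
      calc star (star C.V) * (star C.V * (X : K →L[ℂ] K) * C.V) * star C.V
          = (C.V * star C.V) * (X : K →L[ℂ] K) * (C.V * star C.V) := by
            rw [star_star]
            simp only [mul_assoc]
        _ = X := by rw [C.V_mul_star_V, one_mul, mul_one]))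
    (StarAlgHom.ext fun X => Subtype.ext (by
      change star C.V * (star (star C.V) * (X : K →L[ℂ] K) * star C.V) * C.V = X
      calc star C.V * (star (star C.V) * (X : K →L[ℂ] K) * star C.V) * C.V
          = (star C.V * C.V) * (X : K →L[ℂ] K) * (star C.V * C.V) := by
            rw [star_star]
            simp only [mul_assoc]
        _ = X := by rw [C.star_V_mul_V, one_mul, mul_one]))

theorem coe_automorphism (X : C.algebra.toStarSubalgebra) :
    (C.automorphism X : K →L[ℂ] K) = star C.V * (X : K →L[ℂ] K) * C.V := rfl

theorem coe_automorphism_symm (X : C.algebra.toStarSubalgebra) :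
    (C.automorphism.symm X : K →L[ℂ] K) = C.V * (X : K →L[ℂ] K) * star C.V := by
  change star (star C.V) * (X : K →L[ℂ] K) * star C.V = _
  rw [star_star]

theorem coe_automorphism_zpow_neg (k : ℕ) (X : C.algebra.toStarSubalgebra) :
    ((C.automorphism ^ (-(k : ℤ))) X : K →L[ℂ] K)
      = C.V ^ k * (X : K →L[ℂ] K) * star C.V ^ k := by
  rw [zpow_neg, zpow_natCast, ← inv_pow]
  induction k with
  | zero => simp
  | succ k ih =>
    rw [pow_succ']
    change (C.automorphism.symm ((C.automorphism⁻¹ ^ k) X) : K →L[ℂ] K) = _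
    rw [coe_automorphism_symm, ih, pow_succ' C.V, pow_succ (star C.V)]
    simp only [mul_assoc]

theorem norm_Ω : ‖C.Ω‖ = 1 := by rw [C.Ω_eq, C.Z_isometry, norm_gnsVector]

theorem exists_dilation (hΨ : S.IsStateAdjoint Ψ)
    (hcyclic : IsCyclicVector (Set.centralizer (Set.range S.gnsRep)) S.gnsVector)
    {W : WStarDynamicalSystem S.gnsAlgebra} (hW : S.IsAssociated W) :
    ∃ D : ReversibleDilation W C.algebra, D.automorphism = C.automorphism ∧
      D.expectation = C.expectation hΨ hcyclic ∧
      (∀ X h, (D.embedding X : K →L[ℂ] K) (C.Z h)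
        = C.Z ((X : S.GNSSpace →L[ℂ] S.GNSSpace) h)) ∧
      ∀ X, D.system.state X = ⟪C.Ω, (X : K →L[ℂ] K) C.Ω⟫_ℂ := by
  obtain ⟨i, hi, hiZ⟩ := C.exists_embedding hΨ hcyclic
  have hΩ := C.isCyclicVector_commutant hΨ hcyclic
  have hnormal : IsNormalMap C.algebra C.algebra (C.automorphism : _ →⋆ₐ[ℂ] _) :=
    isNormalMap_of_compression C.V fun X => C.coe_automorphism X
  have hinv : ∀ X : C.algebra.toStarSubalgebra,
      ⟪C.Ω, (C.automorphism X : K →L[ℂ] K) C.Ω⟫_ℂ = ⟪C.Ω, (X : K →L[ℂ] K) C.Ω⟫_ℂ := fun X => by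
    rw [coe_automorphism, mul_assoc, inner_star_mul_apply, C.V_Ω]
    change ⟪C.Ω, (X : K →L[ℂ] K) (C.V C.Ω)⟫_ℂ = _
    rw [C.V_Ω]
  -- Both sides send the separating vector `Ω_∞` to `Z U X Ω_φ`. With `ℰ ∘ i = id`, the dilation
  -- property for all powers follows.
  have hcov : ∀ X, C.automorphism (i X) = i (W.dynamics X) := fun X => by
    refine Subtype.ext (hΩ.eq_of_mem (C.automorphism (i X)).2 (i (W.dynamics X)).2 ?_)
    rw [coe_automorphism]
    change star C.V ((i X : K →L[ℂ] K) (C.V C.Ω)) = _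
    rw [C.V_Ω, C.Ω_eq, hiZ, hiZ, C.star_V_Z, hW.dynamics_eq]
  have hEi : ∀ X, C.expectation hΨ hcyclic (i X) = X := fun X => by
    refine Subtype.ext (ContinuousLinearMap.ext fun h => ?_)
    change adjoint C.Z ((i X : K →L[ℂ] K) (C.Z h)) = _
    rw [hiZ, C.adjoint_Z_Z]
  let sys : WStarDynamicalSystem C.algebra :=
    WStarDynamicalSystem.ofVector hΩ C.norm_Ω (C.automorphism : _ →⋆ₐ[ℂ] _) hnormal hinv
  have hiter : ∀ (n : ℕ) X, (sys.dynamics)^[n] (i X) = i ((W.dynamics)^[n] X) := fun n => by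
    induction n with
    | zero => exact fun X => rfl
    | succ n ih =>
      intro X
      rw [Function.iterate_succ_apply, Function.iterate_succ_apply, ← ih]
      exact congrArg _ (hcov X)
  refine ⟨
    { system := sys
      automorphism := C.automorphism
      dynamics_eq := fun _ => rfl
      embedding := i
      embedding_injective := Function.LeftInverse.injective hEi
      embedding_normal := hi
      expectation := C.expectation hΨ hcyclic
      expectation_ucp := ?_
      expectation_normal := isNormalMap_of_compression C.Z fun _ => rfl
      expectation_embedding_mul := fun X Y => ?_
      expectation_dynamics := fun n X => by rw [hiter, hEi]
      state_eq := fun X => ?_ }, rfl, rfl, hiZ, fun _ => rfl⟩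
  · refine isUCPMap_of_compression ?_ C.algebra.toStarSubalgebra.subtype C.Z fun _ => rfl
    refine Subtype.ext (ContinuousLinearMap.ext fun h => ?_)
    exact C.adjoint_Z_Z h
  · refine Subtype.ext (ContinuousLinearMap.ext fun h => ext_inner_left ℂ fun l => ?_)
    change ⟪l, adjoint C.Z ((i X : K →L[ℂ] K) ((Y : K →L[ℂ] K) (C.Z h)))⟫_ℂ
      = ⟪l, (X : S.GNSSpace →L[ℂ] S.GNSSpace) (adjoint C.Z ((Y : K →L[ℂ] K) (C.Z h)))⟫_ℂ
    have h1 : adjoint (i X : K →L[ℂ] K) (C.Z l)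
        = C.Z (adjoint (X : S.GNSSpace →L[ℂ] S.GNSSpace) l) := by
      have h2 := hiZ (star X) l
      rw [map_star] at h2
      exact h2
    rw [adjoint_inner_right, ← adjoint_inner_left (i X : K →L[ℂ] K), h1,
      ← adjoint_inner_right C.Z, adjoint_inner_left]
  · rw [hW.state_eq]
    change ⟪C.Ω, (X : K →L[ℂ] K) C.Ω⟫_ℂ
      = ⟪S.gnsVector, adjoint C.Z ((X : K →L[ℂ] K) (C.Z S.gnsVector))⟫_ℂ
    rw [adjoint_inner_right, C.Ω_eq]

/-- The negative powers suffice: `Φ̂⁻ᵏ(i(π_φ(a))) = Vᵏ π_∞(a) V*ᵏ`, and these elements exhaust `𝔅`.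
-/
theorem isMinimal_of_automorphism_eq (hΨ : S.IsStateAdjoint Ψ)
    (hcyclic : IsCyclicVector (Set.centralizer (Set.range S.gnsRep)) S.gnsVector)
    {W : WStarDynamicalSystem S.gnsAlgebra} {D : ReversibleDilation W C.algebra}
    (hD : D.automorphism = C.automorphism)
    (hi : ∀ X h, (D.embedding X : K →L[ℂ] K) (C.Z h)
      = C.Z ((X : S.GNSSpace →L[ℂ] S.GNSSpace) h)) : D.IsMinimal := by
  intro R hR
  have hπ : ∀ a, (D.embedding ⟨S.gnsRep a, gnsRep_mem_gnsAlgebra a⟩ : K →L[ℂ] K) = C.π a :=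
    fun a => (C.isCyclicVector_commutant hΨ hcyclic).eq_of_mem (D.embedding _).2
      (le_doubleCommutant (C.π_mem a)) (by rw [C.Ω_eq, hi, C.π_Z])
  refine doubleCommutant_le fun b hb => ?_
  obtain ⟨k, a, rfl⟩ := C.exists_eq_translate hb
  have h := hR (-(k : ℤ)) ⟨S.gnsRep a, gnsRep_mem_gnsAlgebra a⟩
  rwa [hD, coe_automorphism_zpow_neg, hπ] at h

end MultiplicativeSystem.CovariantGNS

end

/-! ### The main theorem -/

theorem proposition5 {A : Type u} [CStarAlgebra A] [PartialOrder A] [StarOrderedRing A]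
    (S : MultiplicativeSystem A)
    (hcyclic : IsCyclicVector (Set.centralizer (Set.range S.gnsRep)) S.gnsVector)
    (Ψ : A →CP A) (hΨ : S.IsStateAdjoint Ψ) :
    (∃ (K : Type u) (_ : NormedAddCommGroup K) (_ : InnerProductSpace ℂ K)
        (_ : CompleteSpace K), Nonempty (S.CovariantGNS K)) ∧
    ∃ W : WStarDynamicalSystem S.gnsAlgebra, S.IsAssociated W ∧
      ∀ (K : Type v) [NormedAddCommGroup K] [InnerProductSpace ℂ K] [CompleteSpace K]
        (C : S.CovariantGNS K),
        ∃ D : ReversibleDilation W C.algebra, D.IsMinimal ∧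
          (∀ X, ((D.embedding X : C.algebra.toStarSubalgebra) : K →L[ℂ] K) C.Ω
            = C.Z ((X : S.GNSSpace →L[ℂ] S.GNSSpace) S.gnsVector)) ∧
          (∀ X, ((D.automorphism X : C.algebra.toStarSubalgebra) : K →L[ℂ] K)
            = star C.V * (X : K →L[ℂ] K) * C.V) ∧
          (∀ X, ((D.expectation X : S.gnsAlgebra.toStarSubalgebra) :
              S.GNSSpace →L[ℂ] S.GNSSpace)
            = (ContinuousLinearMap.adjoint C.Z) ∘L (X : K →L[ℂ] K) ∘L C.Z) ∧
          (∀ (k : ℕ) (a : A),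
            ((D.expectation (C.translate k a) : S.gnsAlgebra.toStarSubalgebra) :
              S.GNSSpace →L[ℂ] S.GNSSpace) = S.gnsRep (Ψ^[k] a)) ∧
          (∀ X, D.system.state X = ⟪C.Ω, (X : K →L[ℂ] K) C.Ω⟫_ℂ) := by
  refine ⟨⟨unitaryExtensionSpace S.U, inferInstance, inferInstance, inferInstance,
    ⟨S.extensionCovariantGNS⟩⟩, ?_⟩
  obtain ⟨Θ, hΘ, hΘU⟩ := MultiplicativeSystem.exists_extended_dynamics hcyclic hΨ
  have hΘΩ : ∀ X : S.gnsAlgebra.toStarSubalgebra,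
      (Θ X : S.GNSSpace →L[ℂ] S.GNSSpace) S.gnsVector
        = S.U ((X : S.GNSSpace →L[ℂ] S.GNSSpace) S.gnsVector) := fun X => by
    rw [← hΘU, S.U_gnsVector]
  -- Invariance of the vector state: `⟨Ω_φ, U X Ω_φ⟩ = ⟨U* Ω_φ, X Ω_φ⟩` and `U* Ω_φ = Ω_φ`.
  let W : WStarDynamicalSystem S.gnsAlgebra := WStarDynamicalSystem.ofVector
    (MultiplicativeSystem.isCyclicVector_commutant_gnsAlgebra hcyclic)
    MultiplicativeSystem.norm_gnsVector Θ hΘ fun X => by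
      rw [hΘΩ, ← ContinuousLinearMap.adjoint_inner_left, S.adjoint_U_gnsVector]
  have hW : S.IsAssociated W := ⟨hΘΩ, fun _ => rfl⟩
  refine ⟨W, hW, fun K _ _ _ C => ?_⟩
  obtain ⟨D, hDa, hDe, hDi, hDs⟩ := C.exists_dilation hΨ hcyclic hW
  refine ⟨D, C.isMinimal_of_automorphism_eq hΨ hcyclic hDa hDi, fun X => ?_, fun X => ?_,
    fun X => ?_, fun k a => ?_, hDs⟩
  · rw [C.Ω_eq, hDi]
  · rw [hDa, C.coe_automorphism]
  · rw [hDe]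
    rfl
  · rw [hDe]
    exact C.compression_translate hΨ hcyclic k a
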